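/- A *hyperfield* is a set $H$ with a multivalued addition $+:H\times H\to 2^H$ and a commutative, associative, unital single-valued multiplication such that: $(x+y)+z=x+(y+z)$; $x+y=y+x$; there is $0$ with $x+0=\{x\}$ for all $x$; each $x$ has a unique $-x$ with $0\in x+(-x)$; $x\in y-z\iff y\in x+z$; $(x+y)z\subseteq xz+yz$; $0\ne 1$, $0\cdot x=0$, and every nonzero element is invertible. It is a *field* if every sum $x+y$ has exactly one element. A *valued hyperfield* is a hyperfield with a map $|\cdot|:H\to\mathbb R_{\ge 0}$ such that: $|x|=0\iff x=0$; $|xy|=|x||y|$; $|z|\le\max(|x|,|y|)$ for $z\in x+y$; the absolute value is constant on $x+y$ if $0\notin x+y$ (so $d(x,y)=|x-y|$ for $x\ne y$, $d(x,x)=0$, defines a metric); and there is $\rho\ge 0$ such that either every $x+y$ is a closed ball of radius $\rho\max(|x|,|y|)$, or every $x+y$ with $x,y$ not both $0$ is an open ball of that radius. The smallest such $\rho$ is denoted $\rho_H$. $H$ is *discretely valued* if $0$ is the only non-isolated point of $\{|x| : x\in H\}$; then $\theta_H$ is the largest element of $\{|x|: x\in H\setminus\{0\}\}$ which is less than $1$.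 A morphism $f:H_1\to H_2$ of valued hyperfields is a map with $f(xy)=f(x)f(y)$, $f^{-1}(a+b)=f^{-1}(a)+f^{-1}(b)$ for $a,b\in f(H_1)$, $|f(x)|=|x|$, and such that $f^{-1}(1)$ is an (open or closed) ball. A *triple* $(R,M,\epsilon)$ consists of a local Artinian commutative ring $R$ with principal maximal ideal $\mathfrak m_R$, a free $R$-module $M$ of rank $1$, and an $R$-linear map $\epsilon:M\to R$ with image $\mathfrak m_R$. A morphism $(r,\phi,\eta):(R,M,\epsilon)\to(R',M',\epsilon')$ consists of an integer $r\ge 1$, a ring homomorphism $\phi:R\to R'$ and an $R$-linear map $\eta:M\to M'^{\otimes r}$ such that $\phi\epsilon=\epsilon'_{0,r}\eta$, where $\epsilon'_{0,r}(x_1\otimes\cdots\otimes x_r)=\epsilon'(x_1)\cdots\epsilon'(x_r)$, and such that the induced map $M\otimes_R R'\to M'^{\otimes r}$ is an isomorphism. Composition is $(r,\phi,\eta)(s,\psi,\zeta)=(rs,\phi\psi,\eta^{\otimes s}\zeta)$. For a discretely valued hyperfield $H$ which is not a field and $i\ge 0$, let $M_i$ be the quotient of $\mathfrak m_H^i=\{x:|x|\le\theta_H^i\}$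 by the relation $d(x,y)\le\rho_H\theta_H^i$. The addition and multiplication of $H$ induce a ring structure on $M_0$ and an $M_0$-module structure on each $M_i$, and $M_i\cong M_1^{\otimes i}$ by sending the class of $\pi^i$ to $\bar\pi^{\otimes i}$ for $|\pi|=\theta_H$. Put $\mathrm{Tr}(H)=(M_0,M_1,\epsilon)$, with $\epsilon$ sending the class of $x$ to the class of $x$. For a morphism $f:H\to H'$ put $\mathrm{Tr}(f)=(r,\phi,\eta)$ where $r=\log\theta_H/\log\theta_{H'}$, $\phi:M_0\to M_0'$ sends the class of $x$ to the class of $f(x)$, and $\eta:M_1\to M'_r\cong M_1'^{\otimes r}$ sends the class of $x$ to the class of $f(x)$. Then $\mathrm{Tr}$ is a functor from the category of discretely valued hyperfields which are not fields to the category of triples. **Theorem.** Let $H$ be a discretely valued hyperfield which is not a field. Then the functor from the coslice category under $H$ to the coslice category under $\mathrm{Tr}(H)$ induced by $\mathrm{Tr}$, $(H\to H')\mapsto(\mathrm{Tr}(H)\to\mathrm{Tr}(H'))$, is an equivalence of categories. The functor from the slice category over $H$ to the slice category over $\mathrm{Tr}(H)$ induced by $\mathrm{Tr}$, $(H'\to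 H)\mapsto(\mathrm{Tr}(H')\to\mathrm{Tr}(H))$, is an equivalence of categories as well. -/

import Mathlib

open CategoryTheory
open scoped TensorProduct

universe u

/-! ### Triples -/

/-- A truncated discrete valuation ring: a local Artinian commutative ring whose maximal ideal
is principal. -/
class IsTruncatedDVR (R : Type*) [CommRing R] : Prop where
  isLocalRing : IsLocalRing R
  isArtinianRing : IsArtinianRing R
  isPrincipal : (IsLocalRing.maximalIdeal R).IsPrincipal

attribute [instance] IsTruncatedDVR.isLocalRing IsTruncatedDVR.isArtinianRing

/-- The tensor power `M^{⊗ n}`, realised as the component of degree `n` of the tensor algebra. -/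
noncomputable abbrev tensorPow (R M : Type*) [CommRing R] [AddCommGroup M] [Module R M] (n : ℕ) :
    Submodule R (TensorAlgebra R M) :=
  LinearMap.range (TensorAlgebra.ι R : M →ₗ[R] TensorAlgebra R M) ^ n

section TensorPowers

variable {R M R' M' N : Type*} [CommRing R] [AddCommGroup M] [Module R M]
  [CommRing R'] [AddCommGroup M'] [Module R' M'] [AddCommGroup N] [Module R' N]

/-- The linear map `ε_{0,n} : M^{⊗ n} → R` sending `x₁ ⊗ ⋯ ⊗ xₙ` to `ε x₁ ⋯ ε xₙ`. -/
noncomputable def epsPow (ε : M →ₗ[R] R) (n : ℕ) : tensorPow R M n →ₗ[R] R :=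
  (TensorAlgebra.lift R ε).toLinearMap.comp (tensorPow R M n).subtype

/-- The `R'`-linear map `R' ⊗[R] M → N` induced by a map `η : M → N` which is linear along
`φ : R → R'`. -/
noncomputable def inducedMap (φ : R →+* R') (η : M →ₛₗ[φ] N) :
    letI : Algebra R R' := φ.toAlgebra
    R' ⊗[R] M →ₗ[R'] N :=
  letI : Algebra R R' := φ.toAlgebra
  letI : Module R N := Module.compHom N φ
  haveI : IsScalarTower R R' N := ⟨fun a b x => mul_smul (φ a) b x⟩
  LinearMap.liftBaseChange R'
    ({ toFun := η, map_add' := η.map_add, map_smul' := η.map_smulₛₗ } : M →ₗ[R] N)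

/-- The ring homomorphism from the tensor algebra of `M` to that of `M'` which extends
`η : M → M'^{⊗ r}`; in degree `n` it is `η^{⊗ n} : M^{⊗ n} → (M'^{⊗ r})^{⊗ n} = M'^{⊗ r n}`. -/
noncomputable def tensorExt (φ : R →+* R') {r : ℕ} (η : M →ₛₗ[φ] tensorPow R' M' r) :
    TensorAlgebra R M →+* TensorAlgebra R' M' :=
  letI : Algebra R (TensorAlgebra R' M') :=
    ((algebraMap R' (TensorAlgebra R' M')).comp φ).toAlgebra'
      fun c x => Algebra.commutes (φ c) x
  (TensorAlgebra.lift R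
    ({ toFun := fun m => (η m : TensorAlgebra R' M')
       map_add' := fun _ _ => by simp
       map_smul' := fun c x => by
        rw [η.map_smulₛₗ, Submodule.coe_smul, Algebra.smul_def]; rfl } :
      M →ₗ[R] TensorAlgebra R' M')).toRingHom

theorem tensorExt_ι (φ : R →+* R') {r : ℕ} (η : M →ₛₗ[φ] tensorPow R' M' r) (m : M) :
    tensorExt φ η (TensorAlgebra.ι R m) = η m := by
  let _ : Algebra R (TensorAlgebra R' M') :=
    ((algebraMap R' (TensorAlgebra R' M')).comp φ).toAlgebra'
      fun c x => Algebra.commutes (φ c) x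
  exact TensorAlgebra.lift_ι_apply _ m

theorem tensorExt_smul (φ : R →+* R') {r : ℕ} (η : M →ₛₗ[φ] tensorPow R' M' r) (c : R)
    (x : TensorAlgebra R M) : tensorExt φ η (c • x) = φ c • tensorExt φ η x := by
  let _ : Algebra R (TensorAlgebra R' M') :=
    ((algebraMap R' (TensorAlgebra R' M')).comp φ).toAlgebra'
      fun c x => Algebra.commutes (φ c) x
  have h : tensorExt φ η (algebraMap R _ c) = algebraMap R' _ (φ c) :=
    AlgHom.commutes (TensorAlgebra.lift R _) c
  rw [Algebra.smul_def, map_mul, h, ← Algebra.smul_def]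

theorem tensorExt_mem (φ : R →+* R') {r : ℕ} (η : M →ₛₗ[φ] tensorPow R' M' r) {n : ℕ}
    {x : TensorAlgebra R M} (hx : x ∈ tensorPow R M n) :
    tensorExt φ η x ∈ tensorPow R' M' (r * n) := by
  induction hx using Submodule.pow_induction_on_left' with
  | algebraMap c =>
    rw [Algebra.algebraMap_eq_smul_one, tensorExt_smul, map_one, mul_zero, tensorPow, pow_zero]
    exact Submodule.smul_mem _ _ (Submodule.one_le.mp le_rfl)
  | add _ _ _ _ _ ihx ihy => rw [map_add]; exact add_mem ihx ihy
  | mem_mul m hm i x hx ih =>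
    obtain ⟨m, rfl⟩ := hm
    rw [map_mul, tensorExt_ι, Nat.succ_eq_add_one, mul_add, mul_one, add_comm, tensorPow, pow_add]
    exact Submodule.mul_mem_mul (η m).2 ih

/-- `η^{⊗ n} : M^{⊗ n} → M'^{⊗ r n}`, for `η : M → M'^{⊗ r}` linear along `φ`. -/
noncomputable def etaPow (φ : R →+* R') {r : ℕ} (η : M →ₛₗ[φ] tensorPow R' M' r) (n : ℕ) :
    tensorPow R M n →ₛₗ[φ] tensorPow R' M' (r * n) where
  toFun x := ⟨tensorExt φ η x, tensorExt_mem φ η x.2⟩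
  map_add' x y := Subtype.ext (map_add (tensorExt φ η) _ _)
  map_smul' c x := Subtype.ext (tensorExt_smul φ η c x)

/-- A generator of a free module of rank one. -/
def IsGen (R : Type*) {M : Type*} [CommRing R] [AddCommGroup M] [Module R M] (m : M) : Prop :=
  Function.Bijective fun a : R => a • m

theorem exists_isGen [Nontrivial R] [Module.Free R M] (h : Module.finrank R M = 1) :
    ∃ m : M, IsGen R m := by
  let b := Module.basisUnique (R := R) (M := M) Unit h
  refine ⟨b (), ⟨fun a c hac => ?_, fun x => ⟨b.repr x (), ?_⟩⟩⟩
  · have := congrArg (fun y => b.repr y ()) hac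
    simpa using this
  · have := b.sum_repr x
    simpa using this

/-- The generator `m ⊗ ⋯ ⊗ m` of `M^{⊗ n}`. -/
noncomputable def genPow (R : Type*) {M : Type*} [CommRing R] [AddCommGroup M] [Module R M]
    (m : M) (n : ℕ) : tensorPow R M n :=
  ⟨TensorAlgebra.ι R m ^ n, Submodule.pow_mem_pow _ (LinearMap.mem_range_self _ m) n⟩

theorem IsGen.genPow {m : M} (hm : IsGen R m) (n : ℕ) : IsGen R (genPow R m n) := by
  constructor
  · intro a b hab
    let l : M →ₗ[R] R := (LinearEquiv.ofBijective (LinearMap.toSpanSingleton R M m) hm).symm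
    have hl : l m = 1 := by
      apply (LinearEquiv.ofBijective (LinearMap.toSpanSingleton R M m) hm).injective
      simp only [l, LinearEquiv.coe_coe, LinearEquiv.apply_symm_apply]
      exact (one_smul R m).symm
    have := congrArg (fun x : tensorPow R M n => TensorAlgebra.lift R l x) hab
    simpa [_root_.genPow, hl] using this
  · rintro ⟨x, hx⟩
    have h1 : LinearMap.range (TensorAlgebra.ι R : M →ₗ[R] TensorAlgebra R M) =
        Submodule.span R {TensorAlgebra.ι R m} := by
      apply le_antisymm
      · rintro _ ⟨y, rfl⟩
        obtain ⟨a, rfl⟩ := hm.2 y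
        rw [map_smul]
        exact Submodule.smul_mem _ _ (Submodule.mem_span_singleton_self _)
      · rw [Submodule.span_singleton_le_iff_mem]
        exact ⟨m, rfl⟩
    rw [tensorPow, h1, Submodule.span_pow, Set.singleton_pow, Submodule.mem_span_singleton] at hx
    obtain ⟨a, ha⟩ := hx
    exact ⟨a, Subtype.ext ha⟩

theorem IsGen.units_smul {m : M} (hm : IsGen R m) {u : R} (hu : IsUnit u) : IsGen R (u • m) := by
  have : (fun a : R => a • u • m) = (fun a : R => a • m) ∘ fun a => a * u := by
    funext a; simp [mul_smul]
  rw [IsGen, this]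
  exact hm.comp (IsUnit.isUnit_iff_mulRight_bijective.mp hu)

theorem IsGen.exists_unit {m x : M} (hm : IsGen R m) (hx : IsGen R x) :
    ∃ u : R, IsUnit u ∧ x = u • m := by
  obtain ⟨u, hu⟩ := hm.2 x
  obtain ⟨v, hv⟩ := hx.2 m
  refine ⟨u, .of_mul_eq_one v (hm.1 ?_), hu.symm⟩
  simp only at hu hv ⊢
  rw [mul_comm, mul_smul, hu, hv, one_smul]

theorem inducedMap_bijective_iff (φ : R →+* R') (η : M →ₛₗ[φ] N) {m : M} (hm : IsGen R m) :
    Function.Bijective (inducedMap φ η) ↔ IsGen R' (η m) := by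
  let _ : Algebra R R' := φ.toAlgebra
  let e : R ≃ₗ[R] M := LinearEquiv.ofBijective (LinearMap.toSpanSingleton R M m) hm
  let E : R' ≃ₗ[R'] R' ⊗[R] M :=
    (TensorProduct.AlgebraTensorModule.rid R R' R').symm ≪≫ₗ
      TensorProduct.AlgebraTensorModule.congr (LinearEquiv.refl R' R') e
  have hE : ∀ a : R', inducedMap φ η (E a) = a • η m := by
    intro a
    have he : e 1 = m := one_smul R m
    simp [E, inducedMap, he]
  have : (fun a : R' => a • η m) = inducedMap φ η ∘ E := funext fun a => (hE a).symm
  rw [IsGen, this]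
  exact (Function.Bijective.of_comp_iff (inducedMap φ η) E.bijective).symm

end TensorPowers

/-- A triple `(R, M, ε)`: a truncated discrete valuation ring `R`, a free `R`-module `M` of rank
one and an `R`-linear map `ε : M → R` whose image is the maximal ideal of `R`. -/
structure Triple : Type (u + 1) where
  R : Type u
  M : Type u
  [commRing : CommRing R]
  [truncated : IsTruncatedDVR R]
  [addCommGroup : AddCommGroup M]
  [module : Module R M]
  [free : Module.Free R M]
  finrank_eq_one : Module.finrank R M = 1
  ε : M →ₗ[R] R
  range_ε : LinearMap.range ε = IsLocalRing.maximalIdeal R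

namespace Triple

attribute [instance] commRing truncated addCommGroup module free

/-- A morphism of triples `(r, φ, η) : (R, M, ε) → (R', M', ε')`: a positive integer `r`, a ring
homomorphism `φ : R → R'` and a map `η : M → M'^{⊗ r}` linear along `φ`, with `φ ε = ε'_{0,r} η`
and such that the induced map `R' ⊗ M → M'^{⊗ r}` is an isomorphism. -/
structure Hom (A B : Triple.{u}) where
  /-- the ramification index -/
  r : ℕ
  r_pos : 0 < r
  φ : A.R →+* B.R
  η : A.M →ₛₗ[φ] tensorPow B.R B.M r
  comm : ∀ x : A.M, φ (A.ε x) = epsPow B.ε r (η x)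
  bijective : Function.Bijective (inducedMap φ η)

theorem Hom.ext {A B : Triple.{u}} {F G : Hom A B} (hr : F.r = G.r) (hφ : ∀ x, F.φ x = G.φ x)
    (hη : ∀ x, (F.η x : TensorAlgebra B.R B.M) = G.η x) : F = G := by
  obtain ⟨r, _, φ, η, _, _⟩ := F
  obtain ⟨r', _, φ', η', _, _⟩ := G
  obtain rfl : r = r' := hr
  obtain rfl : φ = φ' := RingHom.ext hφ
  obtain rfl : η = η' := LinearMap.ext fun x => Subtype.ext (hη x)
  rfl

/-- The identity morphism `(1, id, id)`. -/
noncomputable def Hom.id (A : Triple.{u}) : Hom A A where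
  r := 1
  r_pos := one_pos
  φ := RingHom.id A.R
  η :=
    { toFun := fun m => genPow A.R m 1
      map_add' := fun _ _ => Subtype.ext (by simp [genPow])
      map_smul' := fun _ _ => Subtype.ext (by simp [genPow]) }
  comm x := by simp [epsPow, genPow]
  bijective := by
    obtain ⟨m, hm⟩ := exists_isGen A.finrank_eq_one
    exact (inducedMap_bijective_iff _ _ hm).mpr (hm.genPow 1)

/-- The composite `(r, φ, η) (s, ψ, θ) = (r s, φ ψ, η^{⊗ s} θ)`. -/
noncomputable def Hom.comp {A B C : Triple.{u}} (G : Hom B C) (F : Hom A B) : Hom A C where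
  r := G.r * F.r
  r_pos := Nat.mul_pos G.r_pos F.r_pos
  φ := G.φ.comp F.φ
  η :=
    { toFun := fun x => etaPow G.φ G.η F.r (F.η x)
      map_add' := fun _ _ => by simp
      map_smul' := fun _ _ => by simp }
  comm x := by
    obtain ⟨m, hm⟩ := exists_isGen B.finrank_eq_one
    obtain ⟨a, ha⟩ := (hm.genPow F.r).2 (F.η x)
    have h1 := G.comm m
    change G.φ (F.φ (A.ε x)) = epsPow C.ε _ (etaPow G.φ G.η F.r (F.η x))
    rw [F.comm, ← ha]
    simp only [epsPow, etaPow, genPow, LinearMap.comp_apply, Submodule.subtype_apply,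
      AlgHom.toLinearMap_apply, Submodule.coe_smul, map_smul, map_pow, TensorAlgebra.lift_ι_apply,
      LinearMap.coe_mk, AddHom.coe_mk, tensorExt_smul, tensorExt_ι, smul_eq_mul, map_mul] at h1 ⊢
    rw [h1]
  bijective := by
    obtain ⟨m, hm⟩ := exists_isGen A.finrank_eq_one
    obtain ⟨m', hm'⟩ := exists_isGen B.finrank_eq_one
    obtain ⟨m'', hm''⟩ := exists_isGen C.finrank_eq_one
    rw [inducedMap_bijective_iff _ _ hm]
    obtain ⟨u, hu, h1⟩ := (hm'.genPow F.r).exists_unit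
      ((inducedMap_bijective_iff _ _ hm).mp F.bijective)
    obtain ⟨v, hv, h2⟩ := (hm''.genPow G.r).exists_unit
      ((inducedMap_bijective_iff _ _ hm').mp G.bijective)
    have h3 : etaPow G.φ G.η F.r (F.η m) =
        (G.φ u * v ^ F.r) • genPow C.R m'' (G.r * F.r) := by
      apply Subtype.ext
      rw [h1]
      simp [etaPow, genPow, tensorExt_smul, tensorExt_ι, h2, mul_smul, smul_pow, pow_mul]
    change IsGen C.R (etaPow G.φ G.η F.r (F.η m))
    rw [h3]
    exact (hm''.genPow _).units_smul ((hu.map G.φ).mul (hv.pow _))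

theorem Hom.id_η (A : Triple.{u}) (x : A.M) :
    ((Hom.id A).η x : TensorAlgebra A.R A.M) = TensorAlgebra.ι A.R x := pow_one _

theorem Hom.comp_η {A B C : Triple.{u}} (G : Hom B C) (F : Hom A B) (x : A.M) :
    ((G.comp F).η x : TensorAlgebra C.R C.M) = tensorExt G.φ G.η (F.η x) := rfl

noncomputable instance : Category.{u} Triple.{u} where
  Hom := Hom
  id := Hom.id
  comp F G := G.comp F
  id_comp F := Hom.ext (mul_one _) (fun _ => rfl) fun x => by
    rw [Hom.comp_η, Hom.id_η, tensorExt_ι]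
  comp_id {A B} F := Hom.ext (one_mul _) (fun _ => rfl) fun x => by
    obtain ⟨m, hm⟩ := exists_isGen B.finrank_eq_one
    obtain ⟨a, ha⟩ := (hm.genPow F.r).2 (F.η x)
    rw [Hom.comp_η, ← ha]
    simp only [genPow, Submodule.coe_smul, tensorExt_smul, map_pow, tensorExt_ι, Hom.id_η]
    rfl
  assoc {A B C D} F G K := Hom.ext (mul_assoc _ _ _).symm (fun _ => rfl) fun x => by
    obtain ⟨m, hm⟩ := exists_isGen B.finrank_eq_one
    obtain ⟨a, ha⟩ := (hm.genPow F.r).2 (F.η x)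
    rw [Hom.comp_η, Hom.comp_η, Hom.comp_η, ← ha]
    simp only [genPow, Submodule.coe_smul, tensorExt_smul, map_pow, tensorExt_ι, Hom.comp_η]
    rfl

end Triple
/-! ### Valued hyperfields -/

/-- A hyperfield: the single valued multiplication makes `H` a commutative group with a zero adjoined, and the
multivalued addition `hadd` makes `H` a canonical abelian hypergroup with the same zero. -/
class Hyperfield (H : Type*) extends CommGroupWithZero H, Neg H where
  hadd : H → H → Set H
  hadd_assoc : ∀ x y z : H, (⋃ t ∈ hadd x y, hadd t z) = ⋃ t ∈ hadd y z, hadd x t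
  hadd_comm : ∀ x y : H, hadd x y = hadd y x
  hadd_zero : ∀ x : H, hadd x 0 = {x}
  zero_mem_hadd : ∀ x y : H, 0 ∈ hadd x y ↔ y = -x
  mem_hadd_neg : ∀ x y z : H, x ∈ hadd y (-z) ↔ y ∈ hadd x z
  hadd_mul : ∀ x y z : H, (fun t => t * z) '' hadd x y ⊆ hadd (x * z) (y * z)

open Hyperfield

/-- A hyperfield with an absolute value for which the sums `x + y` not containing `0` have
constant absolute value. -/
class AbsHyperfield (H : Type*) extends Hyperfield H where
  habs : H → ℝ
  habs_nonneg : ∀ x : H, 0 ≤ habs x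
  habs_eq_zero : ∀ x : H, habs x = 0 ↔ x = 0
  habs_mul : ∀ x y : H, habs (x * y) = habs x * habs y
  habs_hadd_le : ∀ x y z : H, z ∈ hadd x y → habs z ≤ max (habs x) (habs y)
  habs_hadd_const : ∀ x y : H, 0 ∉ hadd x y → ∃ a : ℝ, habs '' hadd x y = {a}

open AbsHyperfield

section Metric

variable {H : Type*} [AbsHyperfield H]

open Classical in
/-- The metric `d(x, y) = |x - y|` for `x ≠ y`, and `d(x, x) = 0`. For `x ≠ y` the set of absolute
values of the elements of `x - y` has exactly one element, which is its supremum. -/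
noncomputable def hdist (x y : H) : ℝ := if x = y then 0 else sSup (habs '' hadd x (-y))

/-- Closed balls for the metric `hdist`. -/
def hclosedBall (c : H) (r : ℝ) : Set H := {z | hdist c z ≤ r}

/-- Open balls for the metric `hdist`. -/
def hopenBall (c : H) (r : ℝ) : Set H := {z | hdist c z < r}

end Metric

/-- `ρ ≥ 0` is such that either every sum `x + y` is a closed ball of radius `ρ max(|x|, |y|)`, or
every sum `x + y` is an open ball of radius `ρ max(|x|, |y|)`. (The sum `0 + 0 = {0}` is not
required to be an open ball of radius `0`, since such a ball is empty.) -/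
def IsNormBound (H : Type*) [AbsHyperfield H] (ρ : ℝ) : Prop :=
  0 ≤ ρ ∧
    ((∀ x y : H, ∃ c, hadd x y = hclosedBall c (ρ * max (habs x) (habs y))) ∨
      ∀ x y : H, x ≠ 0 ∨ y ≠ 0 → ∃ c, hadd x y = hopenBall c (ρ * max (habs x) (habs y)))

/-- A valued hyperfield: moreover the sums are balls as described in `IsNormBound`. -/
class ValuedHyperfield (H : Type*) extends AbsHyperfield H where
  exists_isNormBound : ∃ ρ : ℝ, IsNormBound H ρ

/-- The norm `ρ_H` of a valued hyperfield: the smallest `ρ` as in `IsNormBound`. -/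
noncomputable def hnorm (H : Type*) [ValuedHyperfield H] : ℝ := sInf {ρ | IsNormBound H ρ}

/-- The hyperfield `H` is a field, i.e. its addition is single valued. -/
def Hyperfield.IsSingleValued (H : Type*) [Hyperfield H] : Prop :=
  ∀ x y : H, ∃ z, hadd x y = {z}

/-- `H` is discretely valued: `0` is the only non-isolated point of the image of the absolute
value. -/
def IsDiscretelyValued (H : Type*) [ValuedHyperfield H] : Prop :=
  ∀ a ∈ Set.range (habs : H → ℝ),
    AccPt a (Filter.principal (Set.range (habs : H → ℝ))) ↔ a = 0

namespace Hyperfield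

variable {H : Type*} [Hyperfield H]

theorem assoc_right {x y z t w : H} (ht : t ∈ hadd x y) (hw : w ∈ hadd t z) :
    ∃ s ∈ hadd y z, w ∈ hadd x s := by
  have h : w ∈ ⋃ t ∈ hadd x y, hadd t z := Set.mem_biUnion ht hw
  rw [hadd_assoc] at h
  simpa using h

theorem assoc_left {x y z s w : H} (hs : s ∈ hadd y z) (hw : w ∈ hadd x s) :
    ∃ t ∈ hadd x y, w ∈ hadd t z := by
  have h : w ∈ ⋃ s ∈ hadd y z, hadd x s := Set.mem_biUnion hs hw
  rw [← hadd_assoc] at h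
  simpa using h

theorem mem_comm {x y z : H} (h : z ∈ hadd x y) : z ∈ hadd y x := hadd_comm x y ▸ h

theorem mem_zero (x : H) : x ∈ hadd x 0 := by rw [hadd_zero]; rfl

theorem zero_mem_neg (x : H) : 0 ∈ hadd x (-x) := (zero_mem_hadd _ _).2 rfl

theorem hadd_nonempty (x y : H) : (hadd x y).Nonempty := by
  obtain ⟨t, ht, -⟩ := assoc_left (zero_mem_neg y) (mem_zero x)
  exact ⟨t, ht⟩

theorem mul_mem {x y t : H} (z : H) (h : t ∈ hadd x y) : t * z ∈ hadd (x * z) (y * z) :=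
  hadd_mul x y z ⟨t, h, rfl⟩

theorem neg_mul_eq (x y : H) : -x * y = -(x * y) := by
  have := mul_mem y (zero_mem_neg x)
  rw [zero_mul, zero_mem_hadd] at this
  exact this

theorem neg_neg_eq (x : H) : - -x = x :=
  ((zero_mem_hadd _ _).1 (mem_comm (zero_mem_neg x))).symm

theorem neg_mem {x y z : H} (h : z ∈ hadd x y) : -z ∈ hadd (-x) (-y) := by
  have := mul_mem (-1) h
  simpa only [mul_comm _ (-1 : H), neg_mul_eq, one_mul] using this

theorem neg_zero_eq : (-0 : H) = 0 := by
  have h := (zero_mem_hadd (0 : H) 0).1 (mem_zero 0)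
  exact h.symm

/-- From `z ∈ x + y` and `z' ∈ x' + y'` to `z - z' ⊆ (x - x') + (y - y')`. -/
theorem sub_mem {x y z x' y' z' w : H} (hz : z ∈ hadd x y) (hz' : z' ∈ hadd x' y')
    (hw : w ∈ hadd z (-z')) : ∃ a ∈ hadd x (-x'), ∃ b ∈ hadd y (-y'), w ∈ hadd a b := by
  obtain ⟨s, hs, hws⟩ := assoc_right hz hw
  obtain ⟨b, hb, hsb⟩ := assoc_left (mem_comm (neg_mem hz')) hs
  obtain ⟨a, ha, hwa⟩ := assoc_left (mem_comm hsb) hws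
  exact ⟨a, ha, b, hb, hwa⟩

end Hyperfield

section AbsLemmas

variable {H : Type*} [AbsHyperfield H]

theorem habs_zero : habs (0 : H) = 0 := (habs_eq_zero _).2 rfl

theorem habs_pos {x : H} (h : x ≠ 0) : 0 < habs x :=
  lt_of_le_of_ne (habs_nonneg x) fun h' => h ((habs_eq_zero x).1 h'.symm)

theorem habs_one : habs (1 : H) = 1 := by
  have h := habs_mul (1 : H) 1
  have h' := habs_pos (one_ne_zero (α := H))
  rw [mul_one] at h
  nlinarith

theorem habs_neg (x : H) : habs (-x) = habs x := by
  have h1 : habs (-1 : H) = 1 := by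
    have h := habs_mul (-1 : H) (-1)
    rw [neg_mul_eq, one_mul, neg_neg_eq, habs_one] at h
    nlinarith [habs_nonneg (-1 : H)]
  rw [← one_mul x, ← neg_mul_eq, habs_mul, h1, one_mul, one_mul]

/-- The absolute value as a monoid homomorphism. -/
def habsHom (H : Type*) [AbsHyperfield H] : H →*₀ ℝ where
  toFun := habs
  map_zero' := habs_zero
  map_one' := habs_one
  map_mul' := habs_mul

theorem habs_inv (x : H) : habs x⁻¹ = (habs x)⁻¹ := map_inv₀ (habsHom H) x
theorem habs_pow (x : H) (n : ℕ) : habs (x ^ n) = habs x ^ n := map_pow (habsHom H) x n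
theorem habs_zpow (x : H) (n : ℤ) : habs (x ^ n) = habs x ^ n := map_zpow₀ (habsHom H) x n
theorem habs_div (x y : H) : habs (x / y) = habs x / habs y := map_div₀ (habsHom H) x y

theorem zero_notMem_sub {x y : H} (h : x ≠ y) : 0 ∉ hadd x (-y) := by
  rw [zero_mem_hadd]
  intro h'
  apply h
  rw [← neg_neg_eq x, ← h', neg_neg_eq]

theorem hdist_self (x : H) : hdist x x = 0 := if_pos rfl

theorem hdist_eq {x y z : H} (h : x ≠ y) (hz : z ∈ hadd x (-y)) : hdist x y = habs z := by
  obtain ⟨a, ha⟩ := habs_hadd_const _ _ (zero_notMem_sub h)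
  have : habs z = a := by
    have : habs z ∈ ({a} : Set ℝ) := ha ▸ ⟨z, hz, rfl⟩
    simpa using this
  rw [hdist, if_neg h, ha, csSup_singleton, this]

theorem hdist_nonneg (x y : H) : 0 ≤ hdist x y := by
  by_cases h : x = y
  · rw [h, hdist_self]
  · obtain ⟨z, hz⟩ := hadd_nonempty x (-y)
    rw [hdist_eq h hz]; exact habs_nonneg z

theorem hdist_comm (x y : H) : hdist x y = hdist y x := by
  by_cases h : x = y
  · rw [h]
  · obtain ⟨z, hz⟩ := hadd_nonempty x (-y)
    have := mem_comm (neg_mem hz)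
    rw [neg_neg_eq] at this
    rw [hdist_eq h hz, hdist_eq (Ne.symm h) this, habs_neg]

theorem hdist_le_of_mem {x y z : H} (hz : z ∈ hadd x (-y)) : hdist x y ≤ habs z := by
  by_cases h : x = y
  · rw [h, hdist_self]; exact habs_nonneg z
  · rw [hdist_eq h hz]

theorem hdist_zero (x : H) : hdist x 0 = habs x := by
  by_cases h : x = 0
  · rw [h, hdist_self, habs_zero]
  · exact hdist_eq h (by rw [neg_zero_eq]; exact mem_zero x)

theorem hdist_triangle (x y z : H) : hdist x z ≤ max (hdist x y) (hdist y z) := by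
  by_cases hxy : x = y
  · subst hxy; exact le_max_right _ _
  by_cases hyz : y = z
  · subst hyz; exact le_max_left _ _
  by_cases hxz : x = z
  · subst hxz; rw [hdist_self]; exact le_max_of_le_left (hdist_nonneg _ _)
  obtain ⟨w, hw⟩ := hadd_nonempty x (-z)
  obtain ⟨a, ha, hxa⟩ := assoc_left (mem_comm (zero_mem_neg y)) (mem_zero x)
  obtain ⟨b, hb, hwb⟩ := assoc_right hxa hw
  rw [hdist_eq hxz hw, hdist_eq hxy ha, hdist_eq hyz hb]
  exact habs_hadd_le _ _ _ hwb

theorem hdist_mul (x y z : H) : hdist (x * z) (y * z) = hdist x y * habs z := by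
  by_cases hz : z = 0
  · rw [hz, mul_zero, mul_zero, hdist_self, habs_zero, mul_zero]
  by_cases h : x = y
  · rw [h, hdist_self, hdist_self, zero_mul]
  obtain ⟨w, hw⟩ := hadd_nonempty x (-y)
  have := mul_mem z hw
  rw [neg_mul_eq] at this
  rw [hdist_eq h hw, hdist_eq (fun h' => h (mul_right_cancel₀ hz h')) this, habs_mul]

/-- If `d(x, y) < |x|` then `|y| = |x|`. -/
theorem habs_eq_of_hdist_lt {x y : H} (h : hdist x y < habs x) : habs y = habs x := by
  have h1 := hdist_triangle x y 0
  have h2 := hdist_triangle y x 0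
  rw [hdist_zero, hdist_zero] at h1 h2
  rw [hdist_comm y x] at h2
  have h3 : habs x ≤ habs y := by
    rcases le_max_iff.1 h1 with h' | h'
    · exact absurd h' (not_le.2 h)
    · exact h'
  exact le_antisymm (h2.trans (max_le h.le le_rfl)) h3

end AbsLemmas

section ValuedLemmas

/-- Uniform description of the sums in a valued hyperfield; `L` is `≤` or `<`. -/
theorem exists_ball (H : Type*) [ValuedHyperfield H] :
    ∃ ρ : ℝ, IsNormBound H ρ ∧ ∃ L : ℝ → ℝ → Prop, (L = (· ≤ ·) ∨ L = (· < ·)) ∧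
      ∀ x y c : H, x ≠ 0 ∨ y ≠ 0 → c ∈ hadd x y →
        hadd x y = {z | L (hdist c z) (ρ * max (habs x) (habs y))} := by
  obtain ⟨ρ, hρ⟩ := ValuedHyperfield.exists_isNormBound (H := H)
  refine ⟨ρ, hρ, ?_⟩
  rcases hρ.2 with h | h
  · refine ⟨(· ≤ ·), .inl rfl, fun x y c _ hc => ?_⟩
    obtain ⟨c', hc'⟩ := h x y
    have hcc : hdist c' c ≤ _ := hc' ▸ hc
    ext z
    rw [hc']
    exact ⟨fun hz => (hdist_triangle _ c' _).trans (max_le (hdist_comm c c' ▸ hcc) hz),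
      fun hz => (hdist_triangle _ c _).trans (max_le hcc hz)⟩
  · refine ⟨(· < ·), .inr rfl, fun x y c hxy hc => ?_⟩
    obtain ⟨c', hc'⟩ := h x y hxy
    have hcc : hdist c' c < _ := hc' ▸ hc
    ext z
    rw [hc']
    exact ⟨fun hz => (hdist_triangle _ c' _).trans_lt (max_lt (hdist_comm c c' ▸ hcc) hz),
      fun hz => (hdist_triangle _ c _).trans_lt (max_lt hcc hz)⟩

variable {H : Type*} [ValuedHyperfield H]

/-- Two elements of a sum `a + b` which are at least as large as `a` and `b` are equal. -/
theorem eq_of_mem_hadd {a b x y : H} (hx : x ∈ hadd a b) (hy : y ∈ hadd a b)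
    (ha : habs a ≤ habs x) (hb : habs b ≤ habs x) : x = y := by
  by_cases hab : a ≠ 0 ∨ b ≠ 0
  · obtain ⟨ρ, hρ, L, hL, h⟩ := exists_ball H
    have hx0 : x ≠ 0 := by
      rintro rfl
      rw [habs_zero] at ha hb
      rcases hab with h' | h'
      · exact absurd ha (not_le.2 (habs_pos h'))
      · exact absurd hb (not_le.2 (habs_pos h'))
    rw [h a b x hab hx] at hy
    have hle : ρ * max (habs a) (habs b) ≤ ρ * max (habs x) (habs (0 : H)) :=
      mul_le_mul_of_nonneg_left (max_le (le_max_of_le_left ha) (le_max_of_le_left hb)) hρ.1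
    have : y ∈ hadd x 0 := by
      rw [h x 0 x (.inl hx0) (mem_zero x)]
      rcases hL with rfl | rfl
      · exact le_trans hy hle
      · exact lt_of_lt_of_le hy hle
    rw [hadd_zero] at this
    exact (Set.mem_singleton_iff.1 this).symm
  · push Not at hab
    rw [hab.1, hab.2, hadd_zero, Set.mem_singleton_iff] at hx hy
    rw [hx, hy]

end ValuedLemmas

/-- A homomorphism of valued hyperfields: a multiplicative map preserving absolute values, with
`f⁻¹(a + b) = f⁻¹(a) + f⁻¹(b)` for `a, b` in the image, whose fiber over `1` is a ball. -/
@[ext]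
structure VHom (A B : Type*) [ValuedHyperfield A] [ValuedHyperfield B] where
  toFun : A → B
  map_mul : ∀ x y, toFun (x * y) = toFun x * toFun y
  preimage_hadd : ∀ a ∈ Set.range toFun, ∀ b ∈ Set.range toFun,
    toFun ⁻¹' hadd a b = ⋃ x ∈ toFun ⁻¹' {a}, ⋃ y ∈ toFun ⁻¹' {b}, hadd x y
  habs_map : ∀ x, habs (toFun x) = habs x
  fiber_one : ∃ (c : A) (r : ℝ),
    toFun ⁻¹' {1} = hclosedBall c r ∨ toFun ⁻¹' {1} = hopenBall c r

namespace VHom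

variable {A B C : Type*} [ValuedHyperfield A] [ValuedHyperfield B] [ValuedHyperfield C]

theorem map_hadd (f : VHom A B) {x y z : A} (h : z ∈ hadd x y) :
    f.toFun z ∈ hadd (f.toFun x) (f.toFun y) := by
  rw [← Set.mem_preimage, f.preimage_hadd _ ⟨x, rfl⟩ _ ⟨y, rfl⟩]
  simp only [Set.mem_iUnion]
  exact ⟨x, rfl, y, rfl, h⟩

theorem map_zero (f : VHom A B) : f.toFun 0 = 0 := by
  rw [← habs_eq_zero, f.habs_map, habs_zero]

theorem map_one (f : VHom A B) : f.toFun 1 = 1 := by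
  have h := f.map_mul 1 1
  have h0 : f.toFun 1 ≠ 0 := by
    rw [Ne, ← habs_eq_zero, f.habs_map, habs_one]; exact one_ne_zero
  rw [mul_one] at h
  exact (mul_right_cancel₀ h0 (by rw [one_mul]; exact h)).symm

/-- The map `f` as a monoid homomorphism. -/
def monoidHom (f : VHom A B) : A →*₀ B where
  toFun := f.toFun
  map_zero' := f.map_zero
  map_one' := f.map_one
  map_mul' := f.map_mul

theorem map_div (f : VHom A B) (x y : A) : f.toFun (x / y) = f.toFun x / f.toFun y :=
  map_div₀ f.monoidHom x y

theorem map_pow (f : VHom A B) (x : A) (n : ℕ) : f.toFun (x ^ n) = f.toFun x ^ n :=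
  _root_.map_pow f.monoidHom x n

/-- A multiplicative map preserving absolute values and with `f (x + y) ⊆ f x + f y` satisfies the
other conditions as well. This is used to compose homomorphisms. -/
def ofMapHadd (f : A → B) (map_mul : ∀ x y, f (x * y) = f x * f y)
    (map_hadd : ∀ x y z, z ∈ hadd x y → f z ∈ hadd (f x) (f y))
    (habs_map : ∀ x, habs (f x) = habs x) : VHom A B where
  toFun := f
  map_mul := map_mul
  habs_map := habs_map
  preimage_hadd := by
    have map_neg : ∀ x, f (-x) = -f x := fun x => by
      have h0 : f 0 = 0 := by rw [← habs_eq_zero, habs_map, habs_zero]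
      rw [← zero_mem_hadd, ← h0]
      exact map_hadd _ _ _ (zero_mem_neg x)
    have key : ∀ x y z, habs y ≤ habs x → f z ∈ hadd (f x) (f y) →
        ∃ x', f x' = f x ∧ z ∈ hadd x' y := by
      intro x y z hyx hz
      have hzx : habs z ≤ habs x := by
        have := habs_hadd_le _ _ _ hz
        simp only [habs_map] at this
        exact this.trans (max_le le_rfl hyx)
      obtain ⟨x', hx'⟩ := hadd_nonempty z (-y)
      refine ⟨x', ?_, (mem_hadd_neg _ _ _).1 hx'⟩
      have h1 := map_hadd _ _ _ hx'
      rw [map_neg] at h1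
      refine (eq_of_mem_hadd ((mem_hadd_neg _ _ _).2 hz) h1 ?_ ?_).symm
      · rw [habs_map, habs_map]; exact hzx
      · rw [habs_neg, habs_map, habs_map]; exact hyx
    rintro _ ⟨x, rfl⟩ _ ⟨y, rfl⟩
    ext z
    simp only [Set.mem_preimage, Set.mem_iUnion, Set.mem_singleton_iff, exists_prop]
    constructor
    · intro hz
      rcases le_total (habs y) (habs x) with h | h
      · obtain ⟨x', h1, h2⟩ := key x y z h hz
        exact ⟨x', h1, y, rfl, h2⟩
      · obtain ⟨y', h1, h2⟩ := key y x z h (mem_comm hz)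
        exact ⟨x, rfl, y', h1, mem_comm h2⟩
    · rintro ⟨x', h1, y', h2, h3⟩
      rw [← h1, ← h2]
      exact map_hadd _ _ _ h3
  fiber_one := by
    have h0 : f 0 = 0 := by rw [← habs_eq_zero, habs_map, habs_zero]
    have h1 : f 1 = 1 := by
      have h := map_mul 1 1
      have h0 : f 1 ≠ 0 := by
        rw [Ne, ← habs_eq_zero, habs_map, habs_one]; exact one_ne_zero
      rw [mul_one] at h
      exact (mul_right_cancel₀ h0 (by rw [one_mul]; exact h)).symm
    have hneg : f (-1) = -1 := by
      rw [← zero_mem_hadd, ← h0, ← h1]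
      exact h1 ▸ map_hadd _ _ _ (zero_mem_neg 1)
    obtain ⟨ρ, hρ, L, hL, h⟩ := exists_ball B
    have key : f ⁻¹' {1} = {x | L (hdist 1 x) ρ} := by
      have e1 := h 1 0 1 (.inl one_ne_zero) (mem_zero 1)
      have e2 := h 1 (-1) 0 (.inl one_ne_zero) (zero_mem_neg 1)
      rw [hadd_zero, habs_one, habs_zero, max_eq_left zero_le_one, mul_one] at e1
      rw [habs_neg, habs_one, max_self, mul_one] at e2
      ext x
      change f x = 1 ↔ L (hdist 1 x) ρ
      by_cases hx : x = 1
      · subst hx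
        have : (1 : B) ∈ {z : B | L (hdist 1 z) ρ} := e1 ▸ rfl
        rw [Set.mem_ofPred_eq, hdist_self] at this
        rw [hdist_self]
        exact ⟨fun _ => this, fun _ => h1⟩
      · obtain ⟨w, hw⟩ := hadd_nonempty x (-1)
        have hfw := map_hadd _ _ _ hw
        rw [hneg] at hfw
        rw [hdist_comm, hdist_eq hx hw]
        constructor
        · intro hfx
          rw [hfx, e2, Set.mem_ofPred_eq, hdist_comm, hdist_zero, habs_map] at hfw
          exact hfw
        · intro hw'
          by_contra hfx
          apply hfx
          have : f x ∈ ({1} : Set B) := by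
            rw [e1, Set.mem_ofPred_eq, hdist_comm, hdist_eq hfx hfw, habs_map]
            exact hw'
          exact this
    rcases hL with rfl | rfl
    · exact ⟨1, ρ, .inl key⟩
    · exact ⟨1, ρ, .inr key⟩

/-- The identity homomorphism. -/
def id (A : Type*) [ValuedHyperfield A] : VHom A A :=
  ofMapHadd (fun x => x) (fun _ _ => rfl) (fun _ _ _ h => h) fun _ => rfl

/-- The composite `g ∘ f`. -/
def comp (g : VHom B C) (f : VHom A B) : VHom A C :=
  ofMapHadd (fun x => g.toFun (f.toFun x)) (fun x y => by rw [f.map_mul, g.map_mul])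
    (fun _ _ _ h => g.map_hadd (f.map_hadd h)) fun x => by rw [g.habs_map, f.habs_map]

end VHom

/-- A discretely valued hyperfield which is not a field. -/
structure DVHyperfield : Type (u + 1) where
  carrier : Type u
  [valued : ValuedHyperfield carrier]
  discrete : IsDiscretelyValued carrier
  not_field : ¬ IsSingleValued carrier

namespace DVHyperfield

instance : CoeSort DVHyperfield.{u} (Type u) := ⟨carrier⟩

attribute [instance] valued

instance : Category.{u} DVHyperfield.{u} where
  Hom A B := VHom A B
  id A := VHom.id A
  comp f g := g.comp f

/-- `θ_H`: the largest of the absolute values of nonzero elements which is less than `1`. -/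
noncomputable def theta (H : DVHyperfield.{u}) : ℝ :=
  sSup {a | ∃ x : H, x ≠ 0 ∧ habs x = a ∧ a < 1}

/-- `ρ_H`. -/
noncomputable abbrev rho (H : DVHyperfield.{u}) : ℝ := hnorm H

variable (H : DVHyperfield.{u})

theorem theta_spec : (0 < H.theta ∧ H.theta < 1) ∧ (∃ p : H, habs p = H.theta) ∧
    ∀ x : H, x ≠ 0 → habs x < 1 → habs x ≤ H.theta := by
  set V := Set.range (habs : H → ℝ)
  set S := {a | ∃ x : H, x ≠ 0 ∧ habs x = a ∧ a < 1}
  have h0 : AccPt 0 (Filter.principal V) := (H.discrete 0 ⟨0, habs_zero⟩).2 rfl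
  have h1 : ¬ AccPt 1 (Filter.principal V) := fun h =>
    one_ne_zero ((H.discrete 1 ⟨1, habs_one⟩).1 h)
  rw [accPt_iff_nhds] at h0 h1
  push Not at h1
  obtain ⟨U, hU, hU1⟩ := h1
  obtain ⟨ε, hε, hεU⟩ := Metric.mem_nhds_iff.1 hU
  have hiso : ∀ x : H, 1 - ε < habs x → habs x ≤ 1 → habs x = 1 := by
    intro x hx hx1
    apply hU1
    refine ⟨hεU ?_, ⟨x, rfl⟩⟩
    rw [Metric.mem_ball, Real.dist_eq, abs_lt]
    constructor <;> linarith
  obtain ⟨_, ⟨hb, ⟨x0, rfl⟩⟩, hx0⟩ := h0 (Metric.ball 0 1) (Metric.ball_mem_nhds 0 one_pos)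
  rw [Metric.mem_ball, dist_zero_right, Real.norm_eq_abs, abs_of_nonneg (habs_nonneg _)] at hb
  have hx00 : x0 ≠ 0 := fun h => hx0 ((habs_eq_zero _).2 h)
  have hSne : S.Nonempty := ⟨_, x0, hx00, rfl, hb⟩
  have hSbdd : BddAbove S := ⟨1, fun a ⟨_, _, _, h⟩ => h.le⟩
  have hle : ∀ x : H, x ≠ 0 → habs x < 1 → habs x ≤ H.theta :=
    fun x hx hx1 => le_csSup hSbdd ⟨x, hx, rfl, hx1⟩
  have hpos : 0 < H.theta := (habs_pos hx00).trans_le (hle x0 hx00 hb)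
  have hlt : (1 - ε) * H.theta < H.theta := by nlinarith
  obtain ⟨_, ⟨p, hp0, rfl, hp1⟩, hp⟩ := exists_lt_of_lt_csSup hSne hlt
  have hpθ : habs p = H.theta := by
    refine le_antisymm (hle p hp0 hp1) (csSup_le hSne ?_)
    rintro _ ⟨q, hq0, rfl, hq1⟩
    by_contra! hpq
    have hqp := habs_pos hq0
    have : habs (p / q) = 1 := by
      apply hiso
      · rw [habs_div, lt_div_iff₀ hqp]
        by_cases hε1 : 0 ≤ 1 - ε
        · exact lt_of_le_of_lt (mul_le_mul_of_nonneg_left (hle q hq0 hq1) hε1) hp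
        · push Not at hε1
          nlinarith [habs_pos hp0]
      · rw [habs_div, div_le_one hqp]; exact hpq.le
    rw [habs_div, div_eq_one_iff_eq hqp.ne'] at this
    exact hpq.ne this
  exact ⟨⟨hpos, hpθ ▸ hp1⟩, ⟨p, hpθ⟩, hle⟩

theorem theta_pos : 0 < H.theta := H.theta_spec.1.1
theorem theta_lt_one : H.theta < 1 := H.theta_spec.1.2

theorem exists_zpow {x : H} (hx : x ≠ 0) : ∃ n : ℤ, habs x = H.theta ^ n := by
  have hθ := H.theta_pos
  obtain ⟨n, hn1, hn2⟩ := exists_mem_Ioc_zpow (habs_pos hx) ((one_lt_inv₀ hθ).2 H.theta_lt_one)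
  obtain ⟨p, hp⟩ := H.theta_spec.2.1
  have hp0 : p ≠ 0 := by rintro rfl; rw [habs_zero] at hp; exact hθ.ne hp
  rw [inv_zpow'] at hn1 hn2
  refine ⟨-(n + 1), le_antisymm hn2 ?_⟩
  by_contra! hlt
  have hq : x / p ^ (-(n + 1)) ≠ 0 := div_ne_zero hx (zpow_ne_zero _ hp0)
  have hz : 0 < H.theta ^ (-(n + 1)) := zpow_pos hθ _
  have h1 := H.theta_spec.2.2 _ hq (by
    rw [habs_div, habs_zpow, hp, div_lt_one hz]; exact hlt)
  rw [habs_div, habs_zpow, hp, div_le_iff₀ hz, ← zpow_one_add₀ hθ.ne'] at h1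
  have : (1 + -(n + 1) : ℤ) = -n := by ring
  rw [this] at h1
  exact absurd h1 (not_le.2 hn1)

/-- A chosen uniformizer. -/
noncomputable def unif : H := H.theta_spec.2.1.choose

theorem habs_unif : habs H.unif = H.theta := H.theta_spec.2.1.choose_spec

theorem unif_ne_zero : H.unif ≠ 0 := fun h => by
  have := H.habs_unif
  rw [h, habs_zero] at this
  exact H.theta_pos.ne this

theorem zpow_le_iff {m n : ℤ} : H.theta ^ m ≤ H.theta ^ n ↔ n ≤ m :=
  zpow_le_zpow_iff_right_of_lt_one₀ H.theta_pos H.theta_lt_one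

theorem zpow_lt_iff {m n : ℤ} : H.theta ^ m < H.theta ^ n ↔ n < m :=
  zpow_lt_zpow_iff_right_of_lt_one₀ H.theta_pos H.theta_lt_one

theorem hdist_zpow {x y : H} (h : x ≠ y) : ∃ n : ℤ, hdist x y = H.theta ^ n := by
  obtain ⟨z, hz⟩ := hadd_nonempty x (-y)
  rw [hdist_eq h hz]
  exact H.exists_zpow fun h0 => zero_notMem_sub h (h0 ▸ hz)

/-- The norm is a positive power of `θ_H`, and sums are closed balls. -/
theorem rho_spec : (∃ k : ℕ, 0 < k ∧ H.rho = H.theta ^ k) ∧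
    ∀ x y c : H, c ∈ hadd x y → hadd x y = hclosedBall c (H.rho * max (habs x) (habs y)) := by
  have hθ := H.theta_pos
  obtain ⟨ρ, hρ, L, hL, h⟩ := exists_ball H
  have hρ0 : 0 < ρ := by
    refine lt_of_le_of_ne hρ.1 fun h0 => H.not_field fun x y => ?_
    obtain ⟨c, hc⟩ := hadd_nonempty x y
    refine ⟨c, ?_⟩
    by_cases hxy : x ≠ 0 ∨ y ≠ 0
    · have hh := h x y c hxy hc
      rw [← h0, zero_mul] at hh
      refine Set.eq_singleton_iff_unique_mem.2 ⟨hc, fun z hz => ?_⟩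
      rw [hh] at hz hc
      by_contra hne
      obtain ⟨n, hn⟩ := H.hdist_zpow (Ne.symm hne)
      have hp := zpow_pos hθ n
      rw [Set.mem_ofPred_eq, hn] at hz
      rcases hL with rfl | rfl
      · exact absurd hz (not_le.2 hp)
      · exact absurd hz (not_lt.2 hp.le)
    · push Not at hxy
      rw [hxy.1, hxy.2, hadd_zero] at hc ⊢
      rw [Set.mem_singleton_iff.1 hc]
  -- the exponent `k`
  have hk : ∃ k : ℤ, ∀ j : ℤ, L (H.theta ^ j) ρ ↔ k ≤ j := by
    have hθ1 : 1 < H.theta⁻¹ := (one_lt_inv₀ hθ).2 H.theta_lt_one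
    rcases hL with rfl | rfl
    · obtain ⟨n, hn1, hn2⟩ := exists_mem_Ico_zpow hρ0 hθ1
      rw [inv_zpow'] at hn1 hn2
      refine ⟨-n, fun j => ⟨fun hj => ?_, fun hj => (H.zpow_le_iff.2 hj).trans hn1⟩⟩
      have := H.zpow_lt_iff.1 (lt_of_le_of_lt hj hn2)
      omega
    · obtain ⟨n, hn1, hn2⟩ := exists_mem_Ioc_zpow hρ0 hθ1
      rw [inv_zpow'] at hn1 hn2
      refine ⟨-n, fun j => ⟨fun hj => ?_, fun hj => lt_of_le_of_lt (H.zpow_le_iff.2 hj) hn1⟩⟩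
      have := H.zpow_lt_iff.1 (lt_of_lt_of_le hj hn2)
      omega
  obtain ⟨k, hk⟩ := hk
  have hL' : ∀ (x y : H) (n : ℤ), L (hdist x y) (ρ * H.theta ^ n) ↔
      hdist x y ≤ H.theta ^ k * H.theta ^ n := by
    intro x y n
    have hn := zpow_pos hθ n
    by_cases hxy : x = y
    · subst hxy
      rw [hdist_self]
      refine ⟨fun _ => (mul_pos (zpow_pos hθ k) hn).le, fun _ => ?_⟩
      rcases hL with rfl | rfl
      · exact (mul_pos hρ0 hn).le
      · exact mul_pos hρ0 hn
    · obtain ⟨m, hm⟩ := H.hdist_zpow hxy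
      have e : H.theta ^ m = H.theta ^ (m - n) * H.theta ^ n := by
        rw [← zpow_add₀ hθ.ne', sub_add_cancel]
      have e' : L (H.theta ^ (m - n) * H.theta ^ n) (ρ * H.theta ^ n) ↔
          L (H.theta ^ (m - n)) ρ := by
        rcases hL with rfl | rfl
        · exact mul_le_mul_iff_left₀ hn
        · exact mul_lt_mul_iff_left₀ hn
      rw [hm, e, e', hk, mul_le_mul_iff_left₀ hn, H.zpow_le_iff]
  have hball : ∀ x y c : H, c ∈ hadd x y →
      hadd x y = hclosedBall c (H.theta ^ k * max (habs x) (habs y)) := by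
    intro x y c hc
    by_cases hxy : x ≠ 0 ∨ y ≠ 0
    · rw [h x y c hxy hc]
      obtain ⟨n, hn⟩ : ∃ n : ℤ, max (habs x) (habs y) = H.theta ^ n := by
        rcases max_cases (habs x) (habs y) with ⟨h1, h2⟩ | ⟨h1, h2⟩ <;> rw [h1]
        · refine H.exists_zpow ?_
          rintro rfl
          rw [habs_zero] at h2
          rcases hxy with h' | h'
          · exact h' rfl
          · exact absurd h2 (not_le.2 (habs_pos h'))
        · refine H.exists_zpow ?_
          rintro rfl
          rw [habs_zero] at h2
          exact absurd h2 (not_lt.2 (habs_nonneg x))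
      ext z
      rw [hn]
      exact hL' c z n
    · push Not at hxy
      obtain ⟨rfl, rfl⟩ := hxy
      rw [hadd_zero, Set.mem_singleton_iff] at hc
      subst hc
      ext z
      rw [hadd_zero]
      rw [habs_zero, max_self, mul_zero, Set.mem_singleton_iff]
      change z = 0 ↔ hdist 0 z ≤ 0
      rw [hdist_comm, hdist_zero]
      exact ⟨fun h => h ▸ habs_zero.le, fun h =>
        (habs_eq_zero z).1 (le_antisymm h (habs_nonneg z))⟩
  have hmem : H.unif ^ k ∈ hadd (1 : H) (-1) := by
    rw [hball 1 (-1) 0 (zero_mem_neg 1)]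
    change hdist _ _ ≤ _
    rw [hdist_comm, hdist_zero, habs_zpow, H.habs_unif, habs_neg, habs_one, max_self, mul_one]
  have hnorm : H.rho = H.theta ^ k := by
    refine IsLeast.csInf_eq ⟨⟨(zpow_pos hθ k).le, .inl fun x y => ?_⟩, ?_⟩
    · obtain ⟨c, hc⟩ := hadd_nonempty x y
      exact ⟨c, hball x y c hc⟩
    · intro ρ' hρ'
      have hd : hdist 0 (H.unif ^ k) = H.theta ^ k := by
        rw [hdist_comm, hdist_zero, habs_zpow, H.habs_unif]
      have h0 := zero_mem_neg (1 : H)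
      rcases hρ'.2 with h' | h'
      · obtain ⟨c, hc⟩ := h' 1 (-1)
        rw [habs_neg, habs_one, max_self, mul_one] at hc
        have m1 : hdist c 0 ≤ ρ' := by rw [hc] at h0; exact h0
        have m2 : hdist c (H.unif ^ k) ≤ ρ' := by rw [hc] at hmem; exact hmem
        rw [← hd]
        exact (hdist_triangle _ c _).trans (max_le (hdist_comm c 0 ▸ m1) m2)
      · obtain ⟨c, hc⟩ := h' 1 (-1) (.inl one_ne_zero)
        rw [habs_neg, habs_one, max_self, mul_one] at hc
        have m1 : hdist c 0 < ρ' := by rw [hc] at h0; exact h0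
        have m2 : hdist c (H.unif ^ k) < ρ' := by rw [hc] at hmem; exact hmem
        rw [← hd]
        exact ((hdist_triangle _ c _).trans_lt (max_lt (hdist_comm c 0 ▸ m1) m2)).le
  have hkpos : 0 < k := by
    by_contra! hk0
    have h10 : (0 : H) ∈ hadd (1 : H) 0 := by
      rw [hball 1 0 1 (mem_zero 1)]
      change hdist _ _ ≤ _
      rw [hdist_zero, habs_one, habs_zero, max_eq_left zero_le_one, mul_one, ← zpow_zero H.theta]
      exact H.zpow_le_iff.2 hk0
    rw [hadd_zero] at h10
    exact zero_ne_one (Set.mem_singleton_iff.1 h10)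
  refine ⟨⟨k.toNat, by omega, ?_⟩, hnorm ▸ hball⟩
  rw [hnorm, ← zpow_natCast, Int.toNat_of_nonneg hkpos.le]

end DVHyperfield

/-! ### The triple of a discretely valued hyperfield -/

namespace DVHyperfield

variable (H : DVHyperfield.{u})

/-- `𝔪_H^i`: the closed ball of radius `θ_H^i` around `0` (note that `d(0, x) = |x|`). -/
abbrev Level (i : ℕ) : Type u := {x : H // habs x ≤ H.theta ^ i}

/-- The relation `d(x, y) ≤ ρ_H θ_H^i` on `𝔪_H^i`. -/
def setoid (i : ℕ) : Setoid (H.Level i) where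
  r x y := hdist x.1 y.1 ≤ H.rho * H.theta ^ i
  iseqv :=
    { refl := fun x => by
        obtain ⟨⟨k, _, hk⟩, _⟩ := H.rho_spec
        rw [hdist_self, hk]
        exact (mul_pos (pow_pos H.theta_pos _) (pow_pos H.theta_pos _)).le
      symm := fun {x y} h => by rw [hdist_comm]; exact h
      trans := fun {x y z} h h' => (hdist_triangle _ y.1 _).trans (max_le h h') }

/-- `M_i`, the quotient of `𝔪_H^i` by the relation `d(x, y) ≤ ρ_H θ_H^i`. -/
def MQuot (i : ℕ) : Type u := Quotient (H.setoid i)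

variable {H} {i : ℕ}

/-- The class in `M_i` of an element of `𝔪_H^i`. -/
def cls (x : H) (hx : habs x ≤ H.theta ^ i) : H.MQuot i := Quotient.mk (H.setoid i) ⟨x, hx⟩

theorem cls_surj (a : H.MQuot i) : ∃ (x : H) (hx : habs x ≤ H.theta ^ i), cls x hx = a := by
  obtain ⟨⟨x, hx⟩, rfl⟩ := Quotient.exists_rep a
  exact ⟨x, hx, rfl⟩

theorem cls_eq_iff {x y : H} {hx : habs x ≤ H.theta ^ i} {hy : habs y ≤ H.theta ^ i} :
    cls x hx = cls y hy ↔ hdist x y ≤ H.rho * H.theta ^ i :=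
  Quotient.eq (r := H.setoid i)

theorem cls_congr {x y : H} {hx : habs x ≤ H.theta ^ i} (h : x = y) :
    cls x hx = cls y (h ▸ hx) := by subst h; rfl

theorem rho_pos : 0 < H.rho := by
  obtain ⟨⟨k, _, hk⟩, _⟩ := H.rho_spec
  rw [hk]; exact pow_pos H.theta_pos k

theorem rho_lt_one : H.rho < 1 := by
  obtain ⟨⟨k, hk0, hk⟩, _⟩ := H.rho_spec
  rw [hk]; exact pow_lt_one₀ H.theta_pos.le H.theta_lt_one hk0.ne'

theorem mem_level {x y z : H} (hx : habs x ≤ H.theta ^ i) (hy : habs y ≤ H.theta ^ i)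
    (h : z ∈ hadd x y) : habs z ≤ H.theta ^ i :=
  (habs_hadd_le _ _ _ h).trans (max_le hx hy)

/-- `|x - x'| ≤ ρ_H θ_H^i` whenever `x, x'` are congruent elements of `𝔪_H^i`. -/
theorem habs_sub_le {x x' a : H} (hx : habs x ≤ H.theta ^ i)
    (h : hdist x x' ≤ H.rho * H.theta ^ i) (ha : a ∈ hadd x (-x')) :
    habs a ≤ H.rho * H.theta ^ i := by
  by_cases hxx : x = x'
  · subst hxx
    rw [H.rho_spec.2 _ _ 0 (zero_mem_neg x)] at ha
    have ha' : hdist 0 a ≤ H.rho * max (habs x) (habs (-x)) := ha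
    rw [hdist_comm, hdist_zero, habs_neg, max_self] at ha'
    exact ha'.trans (mul_le_mul_of_nonneg_left hx rho_pos.le)
  · rw [← hdist_eq hxx ha]; exact h

theorem add_wd {x y z x' y' z' : H} (hx : habs x ≤ H.theta ^ i) (hy : habs y ≤ H.theta ^ i)
    (hxx : hdist x x' ≤ H.rho * H.theta ^ i) (hyy : hdist y y' ≤ H.rho * H.theta ^ i)
    (hz : z ∈ hadd x y) (hz' : z' ∈ hadd x' y') : hdist z z' ≤ H.rho * H.theta ^ i := by
  obtain ⟨w, hw⟩ := hadd_nonempty z (-z')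
  obtain ⟨a, ha, b, hb, hab⟩ := sub_mem hz hz' hw
  exact (hdist_le_of_mem hw).trans ((habs_hadd_le _ _ _ hab).trans
    (max_le (habs_sub_le hx hxx ha) (habs_sub_le hy hyy hb)))

/-- Addition on `M_i`: the class of any element of the sum of two representatives. -/
noncomputable instance : Add (H.MQuot i) where
  add := Quotient.lift₂
    (fun x y => cls (hadd_nonempty x.1 y.1).choose
      (mem_level x.2 y.2 (hadd_nonempty x.1 y.1).choose_spec))
    fun x y _ _ hx hy => cls_eq_iff.2 (add_wd x.2 y.2 hx hy (hadd_nonempty _ _).choose_spec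
      (hadd_nonempty _ _).choose_spec)

theorem cls_add {x y z : H} (hx : habs x ≤ H.theta ^ i) (hy : habs y ≤ H.theta ^ i)
    (h : z ∈ hadd x y) : cls x hx + cls y hy = cls z (mem_level hx hy h) := by
  refine cls_eq_iff.2 (add_wd hx hy ?_ ?_ (hadd_nonempty x y).choose_spec h)
  all_goals
    rw [hdist_self]
    exact (mul_pos rho_pos (pow_pos H.theta_pos _)).le

instance : Zero (H.MQuot i) where
  zero := cls 0 (by rw [habs_zero]; exact (pow_pos H.theta_pos _).le)

theorem cls_zero (h : habs (0 : H) ≤ H.theta ^ i) : cls 0 h = 0 := rfl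

theorem cls_eq_zero {x : H} {hx : habs x ≤ H.theta ^ i} :
    cls x hx = 0 ↔ habs x ≤ H.rho * H.theta ^ i := by
  rw [← hdist_zero x]; exact cls_eq_iff

instance : Neg (H.MQuot i) where
  neg := Quotient.lift (fun x => cls (-x.1) (by rw [habs_neg]; exact x.2)) fun x y h => by
    rw [cls_eq_iff]
    have := hdist_mul x.1 y.1 (-1 : H)
    rw [mul_comm x.1, mul_comm y.1, neg_mul_eq, neg_mul_eq, one_mul, one_mul, habs_neg, habs_one,
      mul_one] at this
    rw [this]; exact h

theorem cls_neg {x : H} (hx : habs x ≤ H.theta ^ i) :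
    -cls x hx = cls (-x) (by rw [habs_neg]; exact hx) := rfl

noncomputable instance : AddCommGroup (H.MQuot i) where
  add_assoc a b c := by
    obtain ⟨x, hx, rfl⟩ := cls_surj a
    obtain ⟨y, hy, rfl⟩ := cls_surj b
    obtain ⟨z, hz, rfl⟩ := cls_surj c
    obtain ⟨t, ht⟩ := hadd_nonempty x y
    obtain ⟨w, hw⟩ := hadd_nonempty t z
    obtain ⟨s, hs, hws⟩ := assoc_right ht hw
    rw [cls_add hx hy ht, cls_add _ hz hw, cls_add hy hz hs, cls_add hx _ hws]
  zero_add a := by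
    obtain ⟨x, hx, rfl⟩ := cls_surj a
    exact cls_add _ hx (mem_comm (mem_zero x))
  add_zero a := by
    obtain ⟨x, hx, rfl⟩ := cls_surj a
    exact cls_add hx _ (mem_zero x)
  nsmul := nsmulRec
  zsmul := zsmulRec
  neg_add_cancel a := by
    obtain ⟨x, hx, rfl⟩ := cls_surj a
    exact cls_add _ hx (mem_comm (zero_mem_neg x))
  add_comm a b := by
    obtain ⟨x, hx, rfl⟩ := cls_surj a
    obtain ⟨y, hy, rfl⟩ := cls_surj b
    obtain ⟨t, ht⟩ := hadd_nonempty x y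
    rw [cls_add hx hy ht, cls_add hy hx (mem_comm ht)]

theorem mul_level {x y : H} (hx : habs x ≤ H.theta ^ 0) (hy : habs y ≤ H.theta ^ i) :
    habs (x * y) ≤ H.theta ^ i := by
  rw [pow_zero] at hx
  rw [habs_mul]
  exact (mul_le_of_le_one_left (habs_nonneg y) hx).trans hy

/-- The multiplication `M_0 × M_i → M_i`. -/
def mulQ (i : ℕ) : H.MQuot 0 → H.MQuot i → H.MQuot i :=
  Quotient.map₂ (fun x y => ⟨x.1 * y.1, mul_level x.2 y.2⟩) fun x x' hx y y' hy => by
    change hdist (x.1 * y.1) (x'.1 * y'.1) ≤ _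
    refine (hdist_triangle _ (x'.1 * y.1) _).trans (max_le ?_ ?_)
    · rw [hdist_mul]
      have hx0 : hdist x.1 x'.1 ≤ H.rho * H.theta ^ 0 := hx
      have hx1 : hdist x.1 x'.1 ≤ H.rho := hx0.trans_eq (by rw [pow_zero, mul_one])
      exact mul_le_mul hx1 y.2 (habs_nonneg _) rho_pos.le
    · rw [mul_comm x'.1, mul_comm x'.1, hdist_mul]
      have hx2 : habs x'.1 ≤ 1 := x'.2.trans_eq (pow_zero _)
      exact (mul_le_of_le_one_right (hdist_nonneg _ _) hx2).trans hy

theorem mulQ_cls {x y : H} (hx : habs x ≤ H.theta ^ 0) (hy : habs y ≤ H.theta ^ i) :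
    mulQ i (cls x hx) (cls y hy) = cls (x * y) (mul_level hx hy) := rfl

theorem mulQ_add (a : H.MQuot 0) (b c : H.MQuot i) :
    mulQ i a (b + c) = mulQ i a b + mulQ i a c := by
  obtain ⟨x, hx, rfl⟩ := cls_surj a
  obtain ⟨y, hy, rfl⟩ := cls_surj b
  obtain ⟨z, hz, rfl⟩ := cls_surj c
  obtain ⟨t, ht⟩ := hadd_nonempty y z
  have h := mul_mem x ht
  rw [mul_comm t, mul_comm y, mul_comm z] at h
  rw [cls_add hy hz ht, mulQ_cls, mulQ_cls, mulQ_cls, cls_add _ _ h]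

theorem add_mulQ (a b : H.MQuot 0) (c : H.MQuot i) :
    mulQ i (a + b) c = mulQ i a c + mulQ i b c := by
  obtain ⟨x, hx, rfl⟩ := cls_surj a
  obtain ⟨y, hy, rfl⟩ := cls_surj b
  obtain ⟨z, hz, rfl⟩ := cls_surj c
  obtain ⟨t, ht⟩ := hadd_nonempty x y
  rw [cls_add hx hy ht, mulQ_cls, mulQ_cls, mulQ_cls, cls_add _ _ (mul_mem z ht)]

theorem mulQ_assoc (a b : H.MQuot 0) (c : H.MQuot i) :
    mulQ i (mulQ 0 a b) c = mulQ i a (mulQ i b c) := by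
  obtain ⟨x, hx, rfl⟩ := cls_surj a
  obtain ⟨y, hy, rfl⟩ := cls_surj b
  obtain ⟨z, hz, rfl⟩ := cls_surj c
  exact cls_congr (mul_assoc x y z)

theorem one_level : habs (1 : H) ≤ H.theta ^ 0 := by rw [habs_one, pow_zero]

theorem one_mulQ (a : H.MQuot i) : mulQ i (cls 1 one_level) a = a := by
  obtain ⟨x, hx, rfl⟩ := cls_surj a
  exact cls_congr (one_mul x)

theorem mulQ_comm (a b : H.MQuot 0) : mulQ 0 a b = mulQ 0 b a := by
  obtain ⟨x, hx, rfl⟩ := cls_surj a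
  obtain ⟨y, hy, rfl⟩ := cls_surj b
  exact cls_congr (mul_comm x y)

variable (H) in
/-- The ring `R = M_0`. -/
def TrR : Type u := H.MQuot 0

/-- The class in `R = M_0` of an element of absolute value at most one. -/
def mkR (x : H) (hx : habs x ≤ 1) : H.TrR := cls (i := 0) x (by rwa [pow_zero])

theorem mkR_surj (a : H.TrR) : ∃ (x : H) (hx : habs x ≤ 1), mkR x hx = a := by
  obtain ⟨x, hx, rfl⟩ := cls_surj (i := 0) a
  exact ⟨x, by rwa [pow_zero] at hx, rfl⟩

noncomputable instance : CommRing H.TrR where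
  __ := (inferInstance : AddCommGroup (H.MQuot 0))
  mul := mulQ 0
  one := cls 1 one_level
  left_distrib := mulQ_add
  right_distrib := add_mulQ
  zero_mul a := by
    obtain ⟨x, hx, rfl⟩ := cls_surj (i := 0) a
    exact cls_congr (zero_mul x)
  mul_zero a := by
    obtain ⟨x, hx, rfl⟩ := cls_surj (i := 0) a
    exact cls_congr (mul_zero x)
  mul_assoc := mulQ_assoc
  one_mul := one_mulQ
  mul_one a := (mulQ_comm _ _).trans (one_mulQ a)
  mul_comm := mulQ_comm

noncomputable instance : Module H.TrR (H.MQuot i) where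
  smul a x := mulQ i a x
  one_smul := one_mulQ
  mul_smul := mulQ_assoc
  smul_zero a := by
    obtain ⟨x, hx, rfl⟩ := cls_surj (i := 0) a
    exact cls_congr (mul_zero x)
  smul_add := mulQ_add
  add_smul := add_mulQ
  zero_smul a := by
    obtain ⟨x, hx, rfl⟩ := cls_surj a
    exact cls_congr (zero_mul x)

theorem mkR_one : mkR (1 : H) habs_one.le = 1 := rfl

theorem mkR_mul {x y : H} (hx : habs x ≤ 1) (hy : habs y ≤ 1) :
    mkR x hx * mkR y hy =
      mkR (x * y) (by rw [habs_mul]; exact mul_le_one₀ hx (habs_nonneg y) hy) := rfl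

theorem mkR_add {x y z : H} (hx : habs x ≤ 1) (hy : habs y ≤ 1) (h : z ∈ hadd x y) :
    mkR x hx + mkR y hy = mkR z ((habs_hadd_le _ _ _ h).trans (max_le hx hy)) :=
  cls_add (i := 0) _ _ h

theorem mkR_eq_iff {x y : H} {hx : habs x ≤ 1} {hy : habs y ≤ 1} :
    mkR x hx = mkR y hy ↔ hdist x y ≤ H.rho :=
  (cls_eq_iff (i := 0)).trans (by rw [pow_zero, mul_one])

theorem mkR_eq_zero {x : H} {hx : habs x ≤ 1} : mkR x hx = 0 ↔ habs x ≤ H.rho := by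
  rw [← hdist_zero x]
  exact mkR_eq_iff (hy := by rw [habs_zero]; exact zero_le_one)

theorem mkR_congr {x y : H} {hx : habs x ≤ 1} (h : x = y) : mkR x hx = mkR y (h ▸ hx) := by
  subst h; rfl

theorem mkR_smul {x y : H} (hx : habs x ≤ 1) (hy : habs y ≤ H.theta ^ i) :
    mkR x hx • cls y hy = cls (x * y) (mul_level (by rwa [pow_zero]) hy) := rfl

theorem mkR_pow {x : H} (hx : habs x ≤ 1) (n : ℕ) :
    mkR x hx ^ n = mkR (x ^ n) (by rw [habs_pow]; exact pow_le_one₀ (habs_nonneg x) hx) := by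
  induction n with
  | zero => rw [pow_zero, ← mkR_one]; exact mkR_congr (pow_zero x).symm
  | succ n ih => rw [pow_succ, ih, mkR_mul]; exact mkR_congr (pow_succ x n).symm

theorem habs_unif_le_one : habs H.unif ≤ 1 := H.habs_unif ▸ H.theta_lt_one.le

instance : Nontrivial H.TrR := by
  refine ⟨⟨0, 1, fun h => ?_⟩⟩
  rw [← mkR_one, eq_comm, mkR_eq_zero, habs_one] at h
  exact absurd h (not_le.2 rho_lt_one)

theorem isUnit_mkR_of_eq {x : H} (hx : habs x = 1) : IsUnit (mkR x hx.le) := by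
  have hx0 : x ≠ 0 := by rintro rfl; rw [habs_zero] at hx; exact zero_ne_one hx
  refine .of_mul_eq_one (mkR x⁻¹ (by rw [habs_inv, hx, inv_one])) ?_
  rw [mkR_mul, ← mkR_one]
  exact mkR_congr (mul_inv_cancel₀ hx0)

theorem mkR_dvd {x y : H} {hx : habs x ≤ 1} {hy : habs y ≤ 1} (h : habs y ≤ habs x) :
    mkR x hx ∣ mkR y hy := by
  by_cases hx0 : x = 0
  · subst hx0
    rw [habs_zero] at h
    obtain rfl := (habs_eq_zero y).1 (le_antisymm h (habs_nonneg y))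
    exact dvd_rfl
  · refine ⟨mkR (y / x) ?_, ?_⟩
    · rw [habs_div, div_le_one (habs_pos hx0)]; exact h
    · rw [mkR_mul]; exact mkR_congr (mul_div_cancel₀ y hx0).symm

theorem isUnit_mkR {x : H} {hx : habs x ≤ 1} : IsUnit (mkR x hx) ↔ habs x = 1 := by
  refine ⟨fun h => ?_, fun h => isUnit_mkR_of_eq h⟩
  obtain ⟨b, hb⟩ := h.exists_right_inv
  obtain ⟨y, hy, rfl⟩ := mkR_surj b
  rw [mkR_mul, ← mkR_one, mkR_eq_iff, hdist_comm] at hb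
  have := habs_eq_of_hdist_lt (lt_of_le_of_lt hb (by rw [habs_one]; exact rho_lt_one))
  rw [habs_mul, habs_one] at this
  nlinarith [habs_nonneg x, habs_nonneg y]

instance : IsLocalRing H.TrR := by
  refine .of_isUnit_or_isUnit_one_sub_self fun a => ?_
  obtain ⟨x, hx, rfl⟩ := mkR_surj a
  rw [isUnit_mkR]
  refine or_iff_not_imp_left.2 fun h => ?_
  have hx1 : habs x < 1 := lt_of_le_of_ne hx h
  obtain ⟨z, hz⟩ := hadd_nonempty 1 (-x)
  have h1 : (1 : H) ∈ hadd z x := (mem_hadd_neg _ _ _).1 hz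
  have hz1 : habs z ≤ 1 := by
    have := habs_hadd_le _ _ _ hz
    rw [habs_neg, habs_one] at this
    exact this.trans (max_le le_rfl hx)
  have h2 : habs z = 1 := by
    have := habs_hadd_le _ _ _ h1
    rw [habs_one] at this
    rcases le_max_iff.1 this with h' | h'
    · exact le_antisymm hz1 h'
    · exact absurd h' (not_le.2 hx1)
  have h3 : (1 : H.TrR) = mkR z hz1 + mkR x hx := by rw [mkR_add _ _ h1]; rfl
  rw [h3, add_sub_cancel_right]
  exact isUnit_mkR.2 h2

variable (H) in
/-- The class of the chosen uniformizer in `R`. -/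
noncomputable def unifR : H.TrR := mkR H.unif habs_unif_le_one

theorem maximalIdeal_eq : IsLocalRing.maximalIdeal H.TrR = Ideal.span {H.unifR} := by
  ext a
  obtain ⟨x, hx, rfl⟩ := mkR_surj a
  rw [IsLocalRing.mem_maximalIdeal, mem_nonunits_iff, isUnit_mkR, Ideal.mem_span_singleton]
  constructor
  · intro h
    refine mkR_dvd ?_
    by_cases hx0 : x = 0
    · rw [hx0, habs_zero]; exact habs_nonneg _
    · rw [H.habs_unif]
      exact H.theta_spec.2.2 x hx0 (lt_of_le_of_ne hx h)
  · intro h h1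
    have := isUnit_of_dvd_unit h (isUnit_mkR_of_eq h1)
    rw [unifR, isUnit_mkR, H.habs_unif] at this
    exact H.theta_lt_one.ne this

theorem unifR_pow_eq_zero : ∃ k : ℕ, H.unifR ^ k = 0 := by
  obtain ⟨⟨k, _, hk⟩, _⟩ := H.rho_spec
  refine ⟨k, ?_⟩
  rw [unifR, mkR_pow, mkR_eq_zero, habs_pow, H.habs_unif, hk]

theorem exists_associated (a : H.TrR) : ∃ n : ℕ, a ∣ H.unifR ^ n ∧ H.unifR ^ n ∣ a := by
  obtain ⟨x, hx, rfl⟩ := mkR_surj a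
  by_cases hx0 : x = 0
  · obtain ⟨k, hk⟩ := unifR_pow_eq_zero (H := H)
    refine ⟨k, ?_⟩
    rw [hk]
    have : mkR x hx = 0 := mkR_congr hx0
    rw [this]
    exact ⟨dvd_rfl, dvd_rfl⟩
  · obtain ⟨n, hn⟩ := H.exists_zpow hx0
    have hn0 : 0 ≤ n := by
      rw [← H.zpow_le_iff, zpow_zero, ← hn]; exact hx
    lift n to ℕ using hn0
    rw [zpow_natCast] at hn
    refine ⟨n, ?_, ?_⟩ <;> rw [unifR, mkR_pow] <;> refine mkR_dvd ?_ <;>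
      rw [hn, habs_pow, H.habs_unif]

instance : IsPrincipalIdealRing H.TrR where
  principal I := by
    classical
    have hex : ∃ n : ℕ, H.unifR ^ n ∈ I := by
      obtain ⟨k, hk⟩ := unifR_pow_eq_zero (H := H)
      exact ⟨k, by rw [hk]; exact I.zero_mem⟩
    refine ⟨H.unifR ^ Nat.find hex, le_antisymm (fun a ha => ?_) ?_⟩
    · obtain ⟨n, h1, h2⟩ := exists_associated a
      refine Ideal.mem_span_singleton.2 (dvd_trans (pow_dvd_pow _ ?_) h2)
      exact Nat.find_min' hex (I.mem_of_dvd h1 ha)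
    · exact (Ideal.span_singleton_le_iff_mem I).2 (Nat.find_spec hex)

instance : IsTruncatedDVR H.TrR where
  isLocalRing := inferInstance
  isArtinianRing := by
    rw [isArtinianRing_iff_isNilpotent_maximalIdeal, maximalIdeal_eq]
    obtain ⟨k, hk⟩ := unifR_pow_eq_zero (H := H)
    exact ⟨k, by rw [Ideal.span_singleton_pow, hk, Ideal.zero_eq_bot, Ideal.span_singleton_eq_bot]⟩
  isPrincipal := IsPrincipalIdealRing.principal _

theorem habs_unif_pow_le : habs (H.unif ^ i) ≤ H.theta ^ i := by rw [habs_pow, H.habs_unif]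

theorem isGen_cls {x : H} (hx : habs x = H.theta ^ i) :
    IsGen H.TrR (cls (i := i) x hx.le) := by
  have hp := pow_pos H.theta_pos i
  have hx0 : x ≠ 0 := by rintro rfl; rw [habs_zero] at hx; exact hp.ne hx
  constructor
  · intro a b hab
    obtain ⟨y, hy, rfl⟩ := mkR_surj a
    obtain ⟨z, hz, rfl⟩ := mkR_surj b
    simp only [mkR_smul] at hab
    rw [cls_eq_iff, hdist_mul, hx] at hab
    exact mkR_eq_iff.2 (le_of_mul_le_mul_right hab hp)
  · intro a
    obtain ⟨y, hy, rfl⟩ := cls_surj a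
    refine ⟨mkR (y / x) ?_, ?_⟩
    · rw [habs_div, hx, div_le_one hp]; exact hy
    · simp only [mkR_smul]; exact cls_congr (div_mul_cancel₀ y hx0)

variable (H) in
/-- The module `M = M_1`. -/
abbrev TrM : Type u := H.MQuot 1

variable (H) in
/-- The class of the chosen uniformizer in `M`. -/
noncomputable def unifM : H.TrM := cls H.unif (by rw [H.habs_unif, pow_one])

theorem isGen_unifM : IsGen H.TrR H.unifM := isGen_cls (by rw [H.habs_unif, pow_one])

/-- The linear equivalence `R ≃ M` sending `1` to the class of the uniformizer. -/
noncomputable def equivM : H.TrR ≃ₗ[H.TrR] H.TrM :=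
  LinearEquiv.ofBijective (LinearMap.toSpanSingleton H.TrR H.TrM H.unifM) isGen_unifM

variable (H) in
/-- The map `ε : M → R` sending the class of `x ∈ 𝔪_H` in `M` to the class of `x` in `R`. -/
noncomputable def epsM : H.TrM →ₗ[H.TrR] H.TrR where
  toFun := Quotient.lift (fun x : H.Level 1 =>
      mkR x.1 (x.2.trans (by rw [pow_one]; exact H.theta_lt_one.le))) fun x y h => by
    rw [mkR_eq_iff]
    have h' : hdist x.1 y.1 ≤ H.rho * H.theta ^ 1 := h
    exact h'.trans (mul_le_of_le_one_right rho_pos.le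
      (pow_le_one₀ H.theta_pos.le H.theta_lt_one.le))
  map_add' a b := by
    obtain ⟨x, hx, rfl⟩ := cls_surj a
    obtain ⟨y, hy, rfl⟩ := cls_surj b
    obtain ⟨z, hz⟩ := hadd_nonempty x y
    rw [cls_add hx hy hz]
    exact (mkR_add _ _ hz).symm
  map_smul' a b := by
    obtain ⟨x, hx, rfl⟩ := mkR_surj a
    obtain ⟨y, hy, rfl⟩ := cls_surj b
    rfl

theorem epsM_cls {x : H} (hx : habs x ≤ H.theta ^ 1) :
    H.epsM (cls x hx) = mkR x (hx.trans (by rw [pow_one]; exact H.theta_lt_one.le)) := rfl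

variable (H) in
/-- The triple `Tr(H) = (R, M, ε)`. -/
noncomputable def trObj : Triple.{u} where
  R := H.TrR
  M := H.TrM
  free := Module.Free.of_equiv equivM
  finrank_eq_one := by rw [← LinearEquiv.finrank_eq (equivM (H := H)), Module.finrank_self]
  ε := H.epsM
  range_ε := by
    rw [maximalIdeal_eq]
    ext a
    rw [LinearMap.mem_range, Ideal.mem_span_singleton]
    constructor
    · rintro ⟨m, rfl⟩
      obtain ⟨c, rfl⟩ := isGen_unifM.2 m
      exact ⟨c, by rw [map_smul, smul_eq_mul, mul_comm]; rfl⟩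
    · rintro ⟨c, rfl⟩
      exact ⟨c • H.unifM, by rw [map_smul, smul_eq_mul, mul_comm]; rfl⟩

/-- The canonical map `M_i → M^{⊗ i}`, an isomorphism, which sends the class of `π^i` to the
`i`-th tensor power of the class of `π`, for a uniformizer `π`. It sends the class of `x` to
`[x / π^i] • [π]^{⊗ i}`. -/
noncomputable def toTensorPow (i : ℕ) : H.MQuot i →ₗ[H.TrR] tensorPow H.TrR H.TrM i :=
  (LinearMap.toSpanSingleton H.TrR _ (genPow H.TrR H.unifM i)).comp
    (LinearEquiv.ofBijective (LinearMap.toSpanSingleton H.TrR (H.MQuot i)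
      (cls (H.unif ^ i) habs_unif_pow_le))
      (isGen_cls (by rw [habs_pow, H.habs_unif]))).symm.toLinearMap

theorem toTensorPow_smul (c : H.TrR) :
    toTensorPow i (c • cls (H.unif ^ i) habs_unif_pow_le) = c • genPow H.TrR H.unifM i := by
  rw [map_smul]
  congr 1
  have : (LinearEquiv.ofBijective (LinearMap.toSpanSingleton H.TrR (H.MQuot i)
      (cls (H.unif ^ i) habs_unif_pow_le))
      (isGen_cls (by rw [habs_pow, H.habs_unif]))).symm (cls (H.unif ^ i) habs_unif_pow_le) = 1 := by
    rw [LinearEquiv.symm_apply_eq]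
    exact (one_smul H.TrR (cls (H.unif ^ i) habs_unif_pow_le)).symm
  simp only [toTensorPow, LinearMap.comp_apply, LinearEquiv.coe_coe, this]
  exact one_smul H.TrR (genPow H.TrR H.unifM i)

/-- The map `M_i → M^{⊗ i}` does not depend on the choice of the uniformizer. -/
theorem toTensorPow_cls_pow {p : H} (hp : habs p = H.theta) :
    toTensorPow i (cls (p ^ i) (by rw [habs_pow, hp])) =
      genPow H.TrR (cls (i := 1) p (by rw [hp, pow_one])) i := by
  have h0 := H.unif_ne_zero
  have hu : habs (p / H.unif) = 1 := by
    rw [habs_div, hp, H.habs_unif, div_self H.theta_pos.ne']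
  have e1 : cls (i := i) (p ^ i) (by rw [habs_pow, hp]) =
      mkR (p / H.unif) hu.le ^ i • cls (H.unif ^ i) habs_unif_pow_le := by
    rw [mkR_pow, mkR_smul]
    exact cls_congr (by rw [div_pow, div_mul_cancel₀ _ (pow_ne_zero _ h0)])
  have e2 : cls (i := 1) p (by rw [hp, pow_one]) = mkR (p / H.unif) hu.le • H.unifM := by
    rw [unifM, mkR_smul]
    exact cls_congr (by rw [div_mul_cancel₀ _ h0])
  rw [e1, e2, toTensorPow_smul]
  apply Subtype.ext
  simp [genPow, smul_pow]

theorem toTensorPow_bijective : Function.Bijective (toTensorPow (H := H) i) := by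
  have h := isGen_unifM (H := H).genPow i
  exact Function.Bijective.comp (g := fun a : H.TrR => a • genPow H.TrR H.unifM i) h
    (LinearEquiv.bijective (LinearEquiv.ofBijective (LinearMap.toSpanSingleton H.TrR (H.MQuot i)
      (cls (H.unif ^ i) habs_unif_pow_le))
      (isGen_cls (by rw [habs_pow, H.habs_unif]))).symm)

end DVHyperfield

/-! ### Functoriality -/

namespace DVHyperfield

variable {A B C : DVHyperfield.{u}}

/-- The number `log θ_A / log θ_B`, which is a positive integer if there is a homomorphism from
`A` to `B`. -/
noncomputable def ramIdx (A B : DVHyperfield.{u}) : ℕ := ⌊Real.log A.theta / Real.log B.theta⌋₊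

theorem ramIdx_eq {n : ℕ} (h : A.theta = B.theta ^ n) : ramIdx A B = n := by
  have := (Real.log_neg B.theta_pos B.theta_lt_one).ne
  rw [ramIdx, h, Real.log_pow, mul_div_cancel_right₀ _ this, Nat.floor_natCast]

theorem theta_eq_pow (f : VHom A B) : 0 < ramIdx A B ∧ A.theta = B.theta ^ ramIdx A B := by
  have h0 : f.toFun A.unif ≠ 0 := by
    rw [Ne, ← habs_eq_zero, f.habs_map, A.habs_unif]; exact A.theta_pos.ne'
  obtain ⟨n, hn⟩ := B.exists_zpow h0
  rw [f.habs_map, A.habs_unif] at hn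
  have hn0 : 0 < n := by
    rw [← B.zpow_lt_iff, zpow_zero, ← hn]; exact A.theta_lt_one
  lift n to ℕ using hn0.le
  rw [zpow_natCast] at hn
  rw [ramIdx_eq hn]
  exact ⟨by exact_mod_cast hn0, hn⟩

/-- `log θ_A / log θ_B` is an integer. -/
theorem ramIdx_cast (f : VHom A B) :
    (ramIdx A B : ℝ) = Real.log A.theta / Real.log B.theta := by
  have := (Real.log_neg B.theta_pos B.theta_lt_one).ne
  have h := congrArg Real.log (theta_eq_pow f).2
  rw [Real.log_pow] at h
  rw [h, mul_div_cancel_right₀ _ this]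

theorem rho_le (f : VHom A B) : A.rho ≤ B.rho := by
  obtain ⟨⟨k, _, hk⟩, hA⟩ := A.rho_spec
  have h1 : A.unif ^ k ∈ hadd (1 : A) (-1) := by
    rw [hA 1 (-1) 0 (zero_mem_neg 1)]
    change hdist _ _ ≤ _
    rw [hdist_comm, hdist_zero, habs_pow, A.habs_unif, habs_neg, habs_one, max_self, mul_one, hk]
  have h2 := f.map_hadd (zero_mem_neg (1 : A))
  rw [f.map_zero, f.map_one, zero_mem_hadd] at h2
  have h3 := f.map_hadd h1
  rw [f.map_one, h2, B.rho_spec.2 1 (-1) 0 (zero_mem_neg 1)] at h3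
  have h4 : hdist _ _ ≤ _ := h3
  rw [hdist_comm, hdist_zero, f.habs_map, habs_pow, A.habs_unif, habs_neg, habs_one, max_self,
    mul_one, ← hk] at h4
  exact h4

theorem map_neg (f : VHom A B) (x : A) : f.toFun (-x) = -f.toFun x := by
  rw [← zero_mem_hadd]
  have := f.map_hadd (zero_mem_neg x)
  rwa [f.map_zero] at this

theorem hdist_map_le (f : VHom A B) (x y : A) : hdist (f.toFun x) (f.toFun y) ≤ hdist x y := by
  by_cases h : x = y
  · rw [h, hdist_self, hdist_self]
  · obtain ⟨z, hz⟩ := hadd_nonempty x (-y)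
    have := f.map_hadd hz
    rw [map_neg] at this
    rw [hdist_eq h hz, ← f.habs_map]
    exact hdist_le_of_mem this

/-- The ring homomorphism `φ : R → R'` sending the class of `x` to the class of `f x`. -/
noncomputable def trφ (f : VHom A B) : A.TrR →+* B.TrR where
  toFun := Quotient.lift (fun x : A.Level 0 => mkR (f.toFun x.1)
      (by rw [f.habs_map]; exact x.2.trans_eq (pow_zero _))) fun x y h => by
    rw [mkR_eq_iff]
    have h' : hdist x.1 y.1 ≤ A.rho * A.theta ^ 0 := h
    exact (hdist_map_le f _ _).trans
      ((h'.trans_eq (by rw [pow_zero, mul_one])).trans (rho_le f))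
  map_one' := mkR_congr f.map_one
  map_zero' := mkR_congr f.map_zero
  map_mul' a b := by
    obtain ⟨x, hx, rfl⟩ := mkR_surj a
    obtain ⟨y, hy, rfl⟩ := mkR_surj b
    exact mkR_congr (f.map_mul x y)
  map_add' a b := by
    obtain ⟨x, hx, rfl⟩ := mkR_surj a
    obtain ⟨y, hy, rfl⟩ := mkR_surj b
    obtain ⟨z, hz⟩ := hadd_nonempty x y
    rw [mkR_add hx hy hz]
    exact (mkR_add _ _ (f.map_hadd hz)).symm

theorem trφ_mkR (f : VHom A B) {x : A} (hx : habs x ≤ 1) :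
    trφ f (mkR x hx) = mkR (f.toFun x) (by rwa [f.habs_map]) := rfl

theorem map_level (f : VHom A B) {x : A} (hx : habs x ≤ A.theta ^ 1) :
    habs (f.toFun x) ≤ B.theta ^ ramIdx A B := by
  rw [f.habs_map, ← (theta_eq_pow f).2]; rwa [pow_one] at hx

/-- The map `M → M'_r` sending the class of `x` to the class of `f x`. -/
noncomputable def trη₀ (f : VHom A B) : A.TrM →ₛₗ[trφ f] B.MQuot (ramIdx A B) where
  toFun := Quotient.lift (fun x : A.Level 1 => cls (f.toFun x.1) (map_level f x.2))
    fun x y h => by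
      rw [cls_eq_iff, ← (theta_eq_pow f).2]
      have h' : hdist x.1 y.1 ≤ A.rho * A.theta ^ 1 := h
      exact (hdist_map_le f _ _).trans
        ((h'.trans_eq (by rw [pow_one])).trans (mul_le_mul_of_nonneg_right (rho_le f) A.theta_pos.le))
  map_add' a b := by
    obtain ⟨x, hx, rfl⟩ := cls_surj a
    obtain ⟨y, hy, rfl⟩ := cls_surj b
    obtain ⟨z, hz⟩ := hadd_nonempty x y
    rw [cls_add hx hy hz]
    exact (cls_add (map_level f hx) (map_level f hy) (f.map_hadd hz)).symm
  map_smul' a b := by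
    obtain ⟨x, hx, rfl⟩ := mkR_surj a
    obtain ⟨y, hy, rfl⟩ := cls_surj b
    exact cls_congr (f.map_mul x y)

theorem trη₀_cls (f : VHom A B) {x : A} (hx : habs x ≤ A.theta ^ 1) :
    trη₀ f (cls x hx) = cls (f.toFun x) (map_level f hx) := rfl

/-- The map `η : M → M'_r ≅ M'^{⊗ r}`. -/
noncomputable def trη (f : VHom A B) : A.TrM →ₛₗ[trφ f] tensorPow B.TrR B.TrM (ramIdx A B) :=
  (toTensorPow (ramIdx A B)).comp (trη₀ f)

theorem trη_unifM_aux (f : VHom A B) :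
    habs (f.toFun A.unif / B.unif ^ ramIdx A B) = 1 := by
  rw [habs_div, f.habs_map, A.habs_unif, habs_pow, B.habs_unif, ← (theta_eq_pow f).2,
    div_self A.theta_pos.ne']

theorem trη_unifM (f : VHom A B) : trη f A.unifM =
    mkR (f.toFun A.unif / B.unif ^ ramIdx A B) (trη_unifM_aux f).le •
      genPow B.TrR B.unifM (ramIdx A B) := by
  rw [← toTensorPow_smul, mkR_smul]
  change toTensorPow _ (cls _ _) = _
  congr 1
  exact cls_congr (div_mul_cancel₀ _ (pow_ne_zero _ B.unif_ne_zero)).symm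

/-- The morphism of triples `Tr(f) = (r, φ, η)`. -/
noncomputable def trMap (f : VHom A B) : Triple.Hom A.trObj B.trObj where
  r := ramIdx A B
  r_pos := (theta_eq_pow f).1
  φ := trφ f
  η := trη f
  comm x := by
    obtain ⟨c, rfl⟩ := (isGen_unifM (H := A)).2 x
    change trφ f (A.epsM (c • A.unifM)) = epsPow B.epsM _ (trη f (c • A.unifM))
    rw [map_smul, smul_eq_mul, map_mul, LinearMap.map_smulₛₗ, map_smul, smul_eq_mul]
    congr 1
    rw [trη_unifM, map_smul]
    have h1 : epsPow B.epsM (ramIdx A B) (genPow B.TrR B.unifM (ramIdx A B)) =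
        mkR B.unif habs_unif_le_one ^ ramIdx A B := by
      simp only [epsPow, genPow, LinearMap.comp_apply, Submodule.subtype_apply,
        AlgHom.toLinearMap_apply, _root_.map_pow, TensorAlgebra.lift_ι_apply]
      rfl
    rw [h1, mkR_pow, smul_eq_mul, mkR_mul]
    change mkR (f.toFun A.unif) (by rw [f.habs_map]; exact habs_unif_le_one) = _
    exact mkR_congr (div_mul_cancel₀ _ (pow_ne_zero _ B.unif_ne_zero)).symm
  bijective := by
    refine (inducedMap_bijective_iff _ _ (isGen_unifM (H := A))).2 ?_
    change IsGen B.TrR (trη f A.unifM)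
    rw [trη_unifM]
    exact (isGen_unifM.genPow _).units_smul (isUnit_mkR_of_eq (trη_unifM_aux f))

theorem trη_coe (f : VHom A B) {n : ℕ} (hn : ramIdx A B = n) :
    (trη f A.unifM : TensorAlgebra B.TrR B.TrM) =
      mkR (f.toFun A.unif / B.unif ^ n) (hn ▸ (trη_unifM_aux f).le) •
        TensorAlgebra.ι B.TrR B.unifM ^ n := by
  subst hn
  rw [trη_unifM]
  rfl

theorem ramIdx_comp (g : VHom B C) (f : VHom A B) :
    ramIdx A C = ramIdx B C * ramIdx A B :=
  ramIdx_eq (by rw [pow_mul, ← (theta_eq_pow g).2, ← (theta_eq_pow f).2])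

end DVHyperfield

open DVHyperfield in
/-- The functor `Tr` from the category of discretely valued hyperfields which are not fields to
the category of triples: `H ↦ (M_0, M_1, ε)` and `f ↦ (r, φ, η)`. -/
noncomputable def Tr : DVHyperfield.{u} ⥤ Triple.{u} where
  obj H := H.trObj
  map f := trMap f
  map_id H := by
    have h1 : ramIdx H H = 1 := ramIdx_eq (pow_one _).symm
    refine Triple.Hom.ext h1 (fun a => ?_) fun a => ?_
    · obtain ⟨x, hx, rfl⟩ := mkR_surj (H := H) a
      rfl
    · obtain ⟨c, rfl⟩ := (isGen_unifM (H := H)).2 a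
      change (trη (VHom.id H) (c • H.unifM) : TensorAlgebra H.TrR H.TrM) =
        ((Triple.Hom.id H.trObj).η (c • H.unifM) : TensorAlgebra H.trObj.R H.trObj.M)
      refine Eq.trans ?_ (Triple.Hom.id_η H.trObj (c • H.unifM)).symm
      rw [LinearMap.map_smulₛₗ, Submodule.coe_smul, trη_coe _ h1]
      have h2 : trφ (VHom.id H) c = c := by
        obtain ⟨x, hx, rfl⟩ := mkR_surj (H := H) c
        rfl
      have h3 : (VHom.id H).toFun H.unif / H.unif ^ 1 = 1 := by
        rw [pow_one]; exact div_self H.unif_ne_zero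
      rw [h2, mkR_congr h3, mkR_one, one_smul, pow_one]
      exact (map_smul _ _ _).symm
  map_comp {A B C} f g := by
    refine Triple.Hom.ext (ramIdx_comp g f) (fun a => ?_) fun a => ?_
    · obtain ⟨x, hx, rfl⟩ := mkR_surj (H := A) a
      rfl
    · obtain ⟨c, rfl⟩ := (isGen_unifM (H := A)).2 a
      change (trη (VHom.comp g f) (c • A.unifM) : TensorAlgebra C.TrR C.TrM) =
        tensorExt (trφ g) (trη g) (trη f (c • A.unifM))
      have h2 : trφ (VHom.comp g f) c = trφ g (trφ f c) := by
        obtain ⟨x, hx, rfl⟩ := mkR_surj (H := A) c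
        rfl
      rw [LinearMap.map_smulₛₗ, LinearMap.map_smulₛₗ, Submodule.coe_smul, Submodule.coe_smul,
        tensorExt_smul, h2, trη_coe _ (ramIdx_comp g f), trη_coe f rfl, tensorExt_smul, map_pow,
        tensorExt_ι, trη_coe g rfl, smul_pow, ← pow_mul, trφ_mkR, mkR_pow]
      refine congrArg _ ((congrArg (· • _) ?_).trans (mul_smul _ _ _))
      rw [mkR_mul]
      refine mkR_congr ?_
      have h3 : g.toFun B.unif ≠ 0 := by
        rw [Ne, ← habs_eq_zero, g.habs_map, B.habs_unif]; exact B.theta_pos.ne'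
      have h4 := C.unif_ne_zero
      rw [g.map_div, g.map_pow, div_pow, ← pow_mul]
      change g.toFun (f.toFun A.unif) / _ = _
      rw [div_mul_div_cancel₀ (pow_ne_zero _ h3)]

/-! ### The hyperfield of a truncated discrete valuation ring -/

/-! Since x + 0 = {x} is the closed ball of radius ρ|x| about x, an element x of H is known as soon
as it is known up to an error of ρ|x|. After scaling by a power of a uniformizer π, each nonzero
element becomes a unit of the valuation ring and is determined by its class in R = M_0. Likewise,
once scaled so that the larger summand has absolute value 1, a sum is determined by addition in R.
Thus H amounts to R, the class of π, and the number θ_H.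

Faithfulness: a homomorphism f is determined by f(π) and by its values on units. The map η records
f(π) and φ records the values on units, both up to errors that rigidity removes
(`DVHyperfield.trMap_injective`).

The triple does not see θ, and this is the only obstruction to fullness: a morphism (r, φ, η) comes
from a homomorphism A → B as soon as θ_A = θ_B^r (`DVHyperfield.exists_trMap_eq`). Choose p
representing η(π) and send π^n v to p^n w, where w is the unit with class φ[v]. Bijectivity of the
induced map gives |p| = θ_A, and φε = ε'η gives φ[π] = [p], which makes the map compatible with φ on
the whole valuation ring and hence with sums.

Essential surjectivity: for every triple and every θ in (0, 1) there is a hyperfield with that θ and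
an isomorphic triple (`Triple.exists_iso_trObj`). Its nonzero elements are formal products π^n v
with v in R^×. The whole unit v is kept, and this is precision ρ relative to |π^n v|. Addition is
tested by dividing by powers of π and comparing in R. The case R a field is included: then π = 0 in
R and ρ = θ.

Over or under a fixed H the number θ is forced. A morphism H → H' of index r requires θ_{H'} =
θ_H^{1/r}, and a morphism H' → H requires θ_{H'} = θ_H^r. Since indices multiply along a commutative
triangle, morphisms in the (co)slice satisfy the condition for lifting, and both equivalences
follow. -/

/-- A nilpotent generator `π` of the maximal ideal of a local ring `R`, together with a real number
`θ` which will be the absolute value of `π`. -/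
structure ValuedUniformizer (R : Type u) [CommRing R] where
  π : R
  θ : ℝ
  θ_pos : 0 < θ
  θ_lt_one : θ < 1
  isNilpotent : IsNilpotent π
  exists_eq : ∀ a : R, a ≠ 0 → ∃ (n : ℕ) (v : Rˣ), a = π ^ n * v

namespace ValuedUniformizer

variable {R : Type u} [CommRing R] {P : ValuedUniformizer R}

/-! ### Elements, levels and residues. -/

/-- The hyperfield attached to `P`: its nonzero elements are the formal products `π ^ n * v` of a
power of the uniformizer and a unit of `R`. -/
def Hyper (_ : ValuedUniformizer R) : Type u := WithZero (Multiplicative ℤ × Rˣ)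

instance : CommGroupWithZero P.Hyper :=
  inferInstanceAs (CommGroupWithZero (WithZero (Multiplicative ℤ × Rˣ)))

/-- The element `π ^ n * v`. -/
def elt (P : ValuedUniformizer R) (n : ℤ) (v : Rˣ) : P.Hyper :=
  (((Multiplicative.ofAdd n, v) : Multiplicative ℤ × Rˣ) : WithZero (Multiplicative ℤ × Rˣ))

/-- The elements divisible by `π ^ N`. -/
def Lev (N : ℤ) (x : P.Hyper) : Prop :=
  WithZero.recZeroCoe (motive := fun _ => Prop) True (fun g => N ≤ g.1.toAdd) x

/-- The class of `x / π ^ N` in `R`, for `x` divisible by `π ^ N`. -/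
def res (N : ℤ) (x : P.Hyper) : R :=
  -- If the exponent is below N, `toNat` truncates to 0 and the value is meaningless. Zero lies in
  -- every level and has residue 0.
  WithZero.recZeroCoe (motive := fun _ => R) 0
    (fun g => P.π ^ (g.1.toAdd - N).toNat * (g.2 : R)) x

/-- The absolute value `|π ^ n * v| = θ ^ n`. -/
noncomputable def absVal (x : P.Hyper) : ℝ :=
  WithZero.recZeroCoe (motive := fun _ => ℝ) 0 (fun g => P.θ ^ g.1.toAdd) x

theorem eq_zero_or_elt (x : P.Hyper) : x = 0 ∨ ∃ n v, x = P.elt n v := by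
  induction x using WithZero.recZeroCoe with
  | zero => exact .inl rfl
  | coe g => exact .inr ⟨g.1.toAdd, g.2, rfl⟩

theorem elt_ne_zero (n : ℤ) (v : Rˣ) : P.elt n v ≠ 0 := WithZero.coe_ne_zero

theorem elt_inj {m n : ℤ} {v w : Rˣ} : P.elt m v = P.elt n w ↔ m = n ∧ v = w :=
  WithZero.coe_inj.trans Prod.mk_inj

theorem elt_mul (m n : ℤ) (v w : Rˣ) : P.elt m v * P.elt n w = P.elt (m + n) (v * w) := rfl

@[simp] theorem lev_zero (N : ℤ) : Lev N (0 : P.Hyper) := trivial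
@[simp] theorem lev_elt {N n : ℤ} {v : Rˣ} : Lev N (P.elt n v) ↔ N ≤ n := Iff.rfl
@[simp] theorem res_zero (N : ℤ) : res N (0 : P.Hyper) = 0 := rfl
theorem res_elt (N n : ℤ) (v : Rˣ) : res N (P.elt n v) = P.π ^ (n - N).toNat * v := rfl
@[simp] theorem absVal_zero : absVal (0 : P.Hyper) = 0 := rfl
@[simp] theorem absVal_elt (n : ℤ) (v : Rˣ) : absVal (P.elt n v) = P.θ ^ n := rfl

theorem res_elt_self (n : ℤ) (v : Rˣ) : res n (P.elt n v) = v := by simp [res_elt]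

theorem Lev.mono {M N : ℤ} (h : M ≤ N) {x : P.Hyper} (hx : Lev N x) : Lev M x := by
  obtain rfl | ⟨n, v, rfl⟩ := eq_zero_or_elt x
  · trivial
  · exact h.trans hx

/-- The residue at a smaller M carries no information beyond the one at N, because dividing by fewer
factors π only multiplies by a power of π. For this reason a single level, the largest one
containing both summands, governs a sum. -/
theorem res_of_le {M N : ℤ} (h : M ≤ N) {x : P.Hyper} (hx : Lev N x) :
    res M x = P.π ^ (N - M).toNat * res N x := by
  obtain rfl | ⟨n, v, rfl⟩ := eq_zero_or_elt x
  · simp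
  · rw [lev_elt] at hx
    rw [res_elt, res_elt, ← mul_assoc, ← pow_add]
    congr 2
    omega

theorem Lev.mul {M N : ℤ} {x y : P.Hyper} (hx : Lev M x) (hy : Lev N y) : Lev (M + N) (x * y) := by
  obtain rfl | ⟨n, v, rfl⟩ := eq_zero_or_elt x
  · rw [zero_mul]; trivial
  obtain rfl | ⟨m, w, rfl⟩ := eq_zero_or_elt y
  · rw [mul_zero]; trivial
  rw [elt_mul, lev_elt]
  exact add_le_add hx hy

theorem res_mul {M N : ℤ} {x y : P.Hyper} (hx : Lev M x) (hy : Lev N y) :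
    res (M + N) (x * y) = res M x * res N y := by
  obtain rfl | ⟨n, v, rfl⟩ := eq_zero_or_elt x
  · simp
  obtain rfl | ⟨m, w, rfl⟩ := eq_zero_or_elt y
  · simp
  rw [lev_elt] at hx hy
  have h : (n + m - (M + N)).toNat = (n - M).toNat + (m - N).toNat := by omega
  rw [elt_mul, res_elt, res_elt, res_elt, h, pow_add, Units.val_mul]
  ring

/-- Surjectivity of the residue map on a level. It makes sums nonempty and `ringHom` surjective. -/
theorem exists_res (N : ℤ) (a : R) : ∃ x : P.Hyper, Lev N x ∧ res N x = a := by
  by_cases h : a = 0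
  · exact ⟨0, trivial, h.symm⟩
  · obtain ⟨n, v, rfl⟩ := P.exists_eq a h
    refine ⟨P.elt (N + n) v, by simp, ?_⟩
    simp [res_elt]

theorem lev_iff {N : ℤ} {x : P.Hyper} : Lev N x ↔ absVal x ≤ P.θ ^ N := by
  obtain rfl | ⟨n, v, rfl⟩ := eq_zero_or_elt x
  · simpa using (zpow_pos P.θ_pos N).le
  · rw [lev_elt, absVal_elt, zpow_le_zpow_iff_right_of_lt_one₀ P.θ_pos P.θ_lt_one]

theorem absVal_nonneg (x : P.Hyper) : 0 ≤ absVal x := by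
  obtain rfl | ⟨n, v, rfl⟩ := eq_zero_or_elt x
  · exact le_rfl
  · exact (zpow_pos P.θ_pos n).le

theorem absVal_eq_zero (x : P.Hyper) : absVal x = 0 ↔ x = 0 := by
  obtain rfl | ⟨n, v, rfl⟩ := eq_zero_or_elt x
  · simp
  · simp [elt_ne_zero, (zpow_pos P.θ_pos n).ne']

theorem absVal_mul (x y : P.Hyper) : absVal (x * y) = absVal x * absVal y := by
  obtain rfl | ⟨n, v, rfl⟩ := eq_zero_or_elt x
  · simp
  obtain rfl | ⟨m, w, rfl⟩ := eq_zero_or_elt y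
  · simp
  rw [elt_mul, absVal_elt, absVal_elt, absVal_elt, zpow_add₀ P.θ_pos.ne']

/-! ### Negation and hyperaddition. -/

instance : Neg P.Hyper := ⟨fun x => P.elt 0 (-1) * x⟩

theorem neg_def (x : P.Hyper) : -x = P.elt 0 (-1) * x := rfl

@[simp] theorem lev_neg {N : ℤ} {x : P.Hyper} : Lev N (-x) ↔ Lev N x := by
  obtain rfl | ⟨n, v, rfl⟩ := eq_zero_or_elt x
  · rw [neg_def, mul_zero]
  · rw [neg_def, elt_mul, lev_elt, lev_elt, zero_add]

@[simp] theorem res_neg (N : ℤ) (x : P.Hyper) : res N (-x) = -res N x := by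
  obtain rfl | ⟨n, v, rfl⟩ := eq_zero_or_elt x
  · rw [neg_def, mul_zero, res_zero, neg_zero]
  · simp [neg_def, elt_mul, res_elt]

/-- `x + y` consists of the elements whose residues at all levels containing `x`, `y` and `z` are
the sums of those of `x` and `y`. -/
def sum (x y : P.Hyper) : Set P.Hyper :=
  -- For x = y = 0 there is no largest common level, and the condition at all N is what forces z =
  -- 0. In general, the test at the exponent of z excludes a z lying outside a level that contains x
  -- and y.
  {z | ∀ N, Lev N x → Lev N y → Lev N z → res N x + res N y = res N z}

theorem sum_comm (x y : P.Hyper) : sum x y = sum y x := by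
  ext z
  exact ⟨fun h N hx hy hz => (add_comm _ _).trans (h N hy hx hz),
    fun h N hx hy hz => (add_comm _ _).trans (h N hy hx hz)⟩

theorem mem_sum_neg (x y z : P.Hyper) : x ∈ sum y (-z) ↔ y ∈ sum x z := by
  constructor
  · intro h N hx hz hy
    have := h N hy (lev_neg.2 hz) hx
    rw [res_neg] at this
    rw [← this]; ring
  · intro h N hy hz hx
    have := h N hx (lev_neg.1 hz) hy
    rw [res_neg, ← this]; ring

/-- Multiplication by π^n v shifts levels by n and multiplies residues by v, so the condition at N
becomes v times the condition at N - n. -/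
theorem mul_mem_sum {x y t : P.Hyper} (z : P.Hyper) (h : t ∈ sum x y) :
    t * z ∈ sum (x * z) (y * z) := by
  obtain rfl | ⟨n, v, rfl⟩ := eq_zero_or_elt z
  · intro N _ _ _; simp
  · have hl : ∀ {N : ℤ} {w : P.Hyper}, Lev N (w * P.elt n v) ↔ Lev (N - n) w := by
      intro N w
      obtain rfl | ⟨m, v, rfl⟩ := eq_zero_or_elt w
      · simp
      · rw [elt_mul, lev_elt, lev_elt, sub_le_iff_le_add]
    have hr : ∀ {N : ℤ} {w : P.Hyper}, Lev (N - n) w →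
        res N (w * P.elt n v) = res (N - n) w * v := by
      intro N w hw
      have := res_mul hw (lev_elt.2 le_rfl : Lev n (P.elt n v))
      rwa [sub_add_cancel, res_elt_self] at this
    intro N hx hy hz
    rw [hl] at hx hy hz
    rw [hr hx, hr hy, hr hz, ← h _ hx hy hz, add_mul]

/-- An element with the right residue at a level which contains `x` and `y`, one of which
generates that level, belongs to `x + y`. -/
theorem mem_sum_of_res {N : ℤ} {x y z : P.Hyper} (hN : ∀ M, Lev M x → Lev M y → M ≤ N)
    (hx : Lev N x) (hy : Lev N y) (hz : Lev N z) (h : res N x + res N y = res N z) :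
    z ∈ sum x y := by
  intro M hxM hyM hzM
  have hM := hN M hxM hyM
  rw [res_of_le hM hx, res_of_le hM hy, res_of_le hM hz, ← h, mul_add]

/-! ### The length of the ring and the largest level of a pair. -/

/-- The length of `R`: the least `k` with `π ^ k = 0`. -/
noncomputable def length (P : ValuedUniformizer R) : ℕ := by
  classical exact Nat.find P.isNilpotent

theorem π_pow_eq_zero {n : ℕ} : P.π ^ n = 0 ↔ P.length ≤ n := by
  classical
  have : P.length = Nat.find P.isNilpotent := by
    unfold length; congr
  rw [this]
  exact ⟨fun h => Nat.find_min' _ h, fun h => pow_eq_zero_of_le h (Nat.find_spec P.isNilpotent)⟩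

theorem Lev.of_absVal_lt {N : ℤ} {x : P.Hyper} (h : absVal x < P.θ ^ N) : Lev (N + 1) x := by
  obtain rfl | ⟨n, v, rfl⟩ := eq_zero_or_elt x
  · trivial
  · rw [absVal_elt, zpow_lt_zpow_iff_right_of_lt_one₀ P.θ_pos P.θ_lt_one] at h
    rw [lev_elt]
    omega

/-- A unit times π^m vanishes exactly when m is at least the length. This turns vanishing in R into
a bound on absolute values, and it is the source of ρ = θ^length. -/
theorem res_eq_zero {N : ℤ} {x : P.Hyper} (hx : Lev N x) :
    res N x = 0 ↔ Lev (N + P.length) x := by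
  obtain rfl | ⟨n, v, rfl⟩ := eq_zero_or_elt x
  · simp
  · rw [lev_elt] at hx
    rw [res_elt, v.isUnit.mul_left_eq_zero, π_pow_eq_zero, lev_elt]
    omega

theorem max_absVal {N : ℤ} {x y : P.Hyper} (hx : Lev N x) (hy : Lev N y)
    (hN : ∀ M, Lev M x → Lev M y → M ≤ N) : max (absVal x) (absVal y) = P.θ ^ N := by
  refine le_antisymm (max_le (lev_iff.1 hx) (lev_iff.1 hy)) ?_
  by_contra! hlt
  rw [max_lt_iff] at hlt
  have := hN _ (Lev.of_absVal_lt hlt.1) (Lev.of_absVal_lt hlt.2)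
  omega

theorem exists_level {x y : P.Hyper} (h : x ≠ 0 ∨ y ≠ 0) :
    ∃ N, (Lev N x ∧ Lev N y) ∧ ∀ M, Lev M x → Lev M y → M ≤ N := by
  obtain rfl | ⟨n, v, rfl⟩ := eq_zero_or_elt x
  · obtain rfl | ⟨m, w, rfl⟩ := eq_zero_or_elt y
    · simp at h
    · exact ⟨m, ⟨trivial, le_rfl⟩, fun M _ hM => hM⟩
  · obtain rfl | ⟨m, w, rfl⟩ := eq_zero_or_elt y
    · exact ⟨n, ⟨le_rfl, trivial⟩, fun M hM _ => hM⟩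
    · exact ⟨min n m, ⟨min_le_left n m, min_le_right n m⟩, fun M h1 h2 => le_min h1 h2⟩

/-! ### Consequences of locality: exact exponents, levels of sums, uniqueness. -/

variable [IsLocalRing R]

theorem not_isUnit_π (P : ValuedUniformizer R) : ¬ IsUnit P.π := fun h => by
  obtain ⟨n, hn⟩ := P.isNilpotent
  exact not_isUnit_zero (hn ▸ h.pow n)

/-- As π is not a unit, any remaining factor π in the residue prevents it from being a unit. Units
therefore detect the exact exponent. -/
theorem isUnit_res {N : ℤ} {x : P.Hyper} (hx : Lev N x) :
    IsUnit (res N x) ↔ ∃ v, x = P.elt N v := by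
  constructor
  · intro h
    obtain rfl | ⟨n, v, rfl⟩ := eq_zero_or_elt x
    · exact absurd h (by simp)
    · refine ⟨v, ?_⟩
      by_contra hne
      have h0 : (n - N).toNat ≠ 0 := fun h0 => hne (by
        rw [lev_elt] at hx
        rw [show n = N by omega])
      rw [res_elt] at h
      exact P.not_isUnit_π ((isUnit_pow_iff h0).1 (isUnit_of_mul_isUnit_left h))
  · rintro ⟨v, rfl⟩
    rw [res_elt_self]
    exact v.isUnit

/-- The level of the elements of a sum. -/
theorem Lev.sum {N : ℤ} {x y z : P.Hyper} (hx : Lev N x) (hy : Lev N y) (h : z ∈ sum x y) :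
    Lev N z := by
  obtain rfl | ⟨n, v, rfl⟩ := eq_zero_or_elt z
  · trivial
  · rw [lev_elt]
    by_contra! hlt
    have hxn := hx.mono hlt.le
    have hyn := hy.mono hlt.le
    have e := h n hxn hyn (lev_elt.2 le_rfl)
    have aux : ∀ w : P.Hyper, Lev N w → ¬ IsUnit (res n w) := by
      intro w hw hu
      obtain ⟨v, rfl⟩ := (isUnit_res (hw.mono hlt.le)).1 hu
      exact absurd hw (not_le.2 hlt)
    refine IsLocalRing.nonunits_add (aux x hx) (aux y hy) ?_
    rw [e, res_elt_self]
    exact v.isUnit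

/-- Compare at the smaller exponent. One residue there is a unit, so the other is too; the exponents
then agree and the residues are the units themselves. This gives x + 0 = {x} and uniqueness of
negatives. -/
theorem eq_of_res {x y : P.Hyper} (h : ∀ N, Lev N x → Lev N y → res N x = res N y) : x = y := by
  obtain rfl | ⟨n, v, rfl⟩ := eq_zero_or_elt x
  · obtain rfl | ⟨m, w, rfl⟩ := eq_zero_or_elt y
    · rfl
    · have := h m trivial (lev_elt.2 le_rfl)
      rw [res_elt_self, res_zero] at this
      exact absurd this.symm w.ne_zero
  · obtain rfl | ⟨m, w, rfl⟩ := eq_zero_or_elt y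
    · have := h n (lev_elt.2 le_rfl) trivial
      rw [res_elt_self, res_zero] at this
      exact absurd this v.ne_zero
    · have hnm : n = m := by
        rcases le_total n m with hle | hle
        · have e := h n (lev_elt.2 le_rfl) (lev_elt.2 hle)
          rw [res_elt_self] at e
          obtain ⟨_, hw⟩ := (isUnit_res (P := P) (lev_elt.2 hle)).1 (e ▸ v.isUnit)
          exact (elt_inj.1 hw).1.symm
        · have e := h m (lev_elt.2 hle) (lev_elt.2 le_rfl)
          rw [res_elt_self] at e
          obtain ⟨_, hw⟩ := (isUnit_res (P := P) (lev_elt.2 hle)).1 (e ▸ w.isUnit)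
          exact (elt_inj.1 hw).1
      subst hnm
      have e := h n (lev_elt.2 le_rfl) (lev_elt.2 le_rfl)
      rw [res_elt_self, res_elt_self] at e
      rw [Units.ext e]

theorem sum_zero (x : P.Hyper) : sum x 0 = {x} := by
  ext z
  rw [Set.mem_singleton_iff]
  refine ⟨fun h => (eq_of_res fun N hx hz => ?_).symm, ?_⟩
  · simpa using h N hx trivial hz
  · rintro rfl N _ _ _
    simp

theorem zero_mem_sum (x y : P.Hyper) : 0 ∈ sum x y ↔ y = -x := by
  constructor
  · refine fun h => eq_of_res fun N hy hx => ?_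
    have := h N (lev_neg.1 hx) hy trivial
    rw [res_zero] at this
    rw [res_neg]
    exact eq_neg_of_add_eq_zero_right this
  · rintro rfl N _ _ _
    simp

theorem sum_nonempty (x y : P.Hyper) : (sum x y).Nonempty := by
  by_cases h : x ≠ 0 ∨ y ≠ 0
  · obtain ⟨N, ⟨hx, hy⟩, hN⟩ := exists_level h
    obtain ⟨z, hz, e⟩ := exists_res (P := P) N (res N x + res N y)
    exact ⟨z, mem_sum_of_res hN hx hy hz e.symm⟩
  · push Not at h
    rw [h.1, h.2, sum_zero]
    exact Set.singleton_nonempty _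

/-! ### Associativity. -/

/-- The four term relation `x + y + z = w`. -/
def Rel (x y z w : P.Hyper) : Prop :=
  ∀ N, Lev N x → Lev N y → Lev N z → Lev N w → res N x + res N y + res N z = res N w

theorem rel_of_mem {x y z w t : P.Hyper} (ht : t ∈ sum x y) (hw : w ∈ sum t z) : Rel x y z w := by
  intro N hx hy hz hw'
  have htN := hx.sum hy ht
  rw [ht N hx hy htN, hw N htN hz hw']

/-- Levels are nested, so either z and w lie in every level containing x and y, or x and y lie in
every level containing z and w. In the first case t is taken in w - z, in the second in x + y. The
remaining membership then only has to be checked at levels containing all four elements, where the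
relation applies. -/
theorem exists_of_rel {x y z w : P.Hyper} (h : Rel x y z w) : ∃ t ∈ sum x y, w ∈ sum t z := by
  by_cases hxy : ∀ N, Lev N x → Lev N y → Lev N z ∧ Lev N w
  · obtain ⟨t, ht⟩ := sum_nonempty w (-z)
    refine ⟨t, fun N hx hy htN => ?_, (mem_sum_neg _ _ _).1 ht⟩
    obtain ⟨hz, hw⟩ := hxy N hx hy
    have e := ht N hw (lev_neg.2 hz) htN
    rw [← e, ← h N hx hy hz hw, res_neg, add_neg_cancel_right]
  · obtain ⟨t, ht⟩ := sum_nonempty x y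
    refine ⟨t, ht, fun N htN hz hw => ?_⟩
    have key : Lev N x ∧ Lev N y := by
      push Not at hxy
      obtain ⟨M, hxM, hyM, hM⟩ := hxy
      rcases le_total N M with hle | hle
      · exact ⟨hxM.mono hle, hyM.mono hle⟩
      · exact absurd (hw.mono hle) (hM (hz.mono hle))
    rw [← ht N key.1 key.2 htN, h N key.1 key.2 hz hw]

/-- Both sides consist of the w with `Rel x y z w`, and this relation is symmetric in its first
three arguments. -/
theorem sum_assoc (x y z : P.Hyper) : (⋃ t ∈ sum x y, sum t z) = ⋃ t ∈ sum y z, sum x t := by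
  ext w
  simp only [Set.mem_iUnion, exists_prop]
  constructor
  · rintro ⟨t, ht, hw⟩
    have h := rel_of_mem ht hw
    obtain ⟨t', ht', hw'⟩ := exists_of_rel (x := y) (y := z) (z := x) (w := w)
      fun N hy hz hx hw => by rw [← h N hx hy hz hw]; ring
    exact ⟨t', ht', sum_comm t' x ▸ hw'⟩
  · rintro ⟨t, ht, hw⟩
    have h := rel_of_mem ht (sum_comm x t ▸ hw)
    exact exists_of_rel fun N hx hy hz hw => by rw [← h N hy hz hx hw]; ring

instance : Hyperfield P.Hyper where
  hadd := sum
  hadd_assoc := sum_assoc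
  hadd_comm := sum_comm
  hadd_zero := sum_zero
  zero_mem_hadd := zero_mem_sum
  mem_hadd_neg := mem_sum_neg
  hadd_mul x y z := by
    rintro _ ⟨t, ht, rfl⟩
    exact mul_mem_sum z ht

/-! ### The absolute value. -/

theorem absVal_sum_le {x y z : P.Hyper} (h : z ∈ sum x y) :
    absVal z ≤ max (absVal x) (absVal y) := by
  by_cases hxy : x ≠ 0 ∨ y ≠ 0
  · obtain ⟨N, ⟨hx, hy⟩, hN⟩ := exists_level hxy
    have hz := lev_iff.1 (hx.sum hy h)
    obtain rfl | ⟨n, v, rfl⟩ := eq_zero_or_elt z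
    · exact (absVal_nonneg x).trans (le_max_left _ _)
    by_contra! hlt
    rw [max_lt_iff, absVal_elt] at hlt
    obtain ⟨h1, h2⟩ := hlt
    -- Both summands lie in level n + 1, which would put z = π^n v there as well.
    have := (Lev.of_absVal_lt h1).sum (Lev.of_absVal_lt h2) h
    rw [lev_elt] at this
    omega
  · push Not at hxy
    rw [hxy.1, hxy.2, sum_zero, Set.mem_singleton_iff] at h
    rw [h, hxy.1]
    exact le_max_left _ _

/-- If a < b, then π^a (v - π^(b-a) w) = 0. The second factor is a unit minus a nonunit, hence a
unit, so π^a = 0. Without the nonvanishing hypothesis all exponents from the length on would give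
the same element. -/
theorem eq_of_π_pow_mul {a b : ℕ} {v w : Rˣ} (h : P.π ^ a * v = P.π ^ b * w)
    (h0 : P.π ^ a * (v : R) ≠ 0) : a = b := by
  have key : ∀ (a b : ℕ) (v w : Rˣ), P.π ^ a * (v : R) = P.π ^ b * w → P.π ^ a * (v : R) ≠ 0 →
      b ≤ a := by
    intro a b v w h h0
    by_contra! hlt
    obtain ⟨c, rfl⟩ := Nat.exists_eq_add_of_lt hlt
    have hu : IsUnit ((v : R) - P.π * (P.π ^ c * w)) := by
      by_contra hn
      refine IsLocalRing.nonunits_add hn (b := P.π * (P.π ^ c * w))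
        (fun h => P.not_isUnit_π (isUnit_of_mul_isUnit_left h)) ?_
      rw [sub_add_cancel]
      exact v.isUnit
    have e : P.π ^ a * ((v : R) - P.π * (P.π ^ c * w)) = 0 := by
      rw [mul_sub, h]; ring
    rw [hu.mul_left_eq_zero] at e
    rw [e, zero_mul] at h0
    exact h0 rfl
  exact le_antisymm (key b a w v h.symm (h ▸ h0)) (key a b v w h h0)

theorem absVal_eq_of_res {N : ℤ} {x y : P.Hyper} (hx : Lev N x) (hy : Lev N y)
    (h : res N x = res N y) (h0 : res N x ≠ 0) : absVal x = absVal y := by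
  obtain rfl | ⟨n, v, rfl⟩ := eq_zero_or_elt x
  · simp at h0
  obtain rfl | ⟨m, w, rfl⟩ := eq_zero_or_elt y
  · simp [h] at h0
  rw [res_elt] at h0
  rw [res_elt, res_elt] at h
  rw [lev_elt] at hx hy
  have := eq_of_π_pow_mul h h0
  rw [absVal_elt, absVal_elt, show n = m by omega]

noncomputable instance : AbsHyperfield P.Hyper where
  habs := absVal
  habs_nonneg := absVal_nonneg
  habs_eq_zero := absVal_eq_zero
  habs_mul := absVal_mul
  habs_hadd_le _ _ _ := absVal_sum_le
  habs_hadd_const x y h0 := by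
    obtain ⟨z, hz⟩ := sum_nonempty x y
    refine ⟨absVal z, Set.eq_singleton_iff_unique_mem.2 ⟨⟨z, hz, rfl⟩, ?_⟩⟩
    rintro _ ⟨z', hz', rfl⟩
    have hxy : x ≠ 0 ∨ y ≠ 0 := by
      by_contra! h
      refine h0 ?_
      change 0 ∈ sum x y
      rw [h.1, h.2, sum_zero]
      rfl
    obtain ⟨N, ⟨hx, hy⟩, hN⟩ := exists_level hxy
    have e := hz N hx hy (hx.sum hy hz)
    have e' := hz' N hx hy (hx.sum hy hz')
    -- At the largest common level all elements of x + y have the residue of x plus that of y. If it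
    -- vanished, 0 would belong to the sum. Otherwise it determines the absolute value.
    refine absVal_eq_of_res (hx.sum hy hz') (hx.sum hy hz) (e'.symm.trans e) fun h => h0 ?_
    exact mem_sum_of_res hN hx hy trivial (by rw [e', h, res_zero])

theorem habs_eq (x : P.Hyper) : habs x = absVal x := rfl

/-! ### Sums are closed balls. -/

/-- Two elements of a level have the same residue if and only if they are close. -/
theorem hdist_le_iff {N : ℤ} {x y : P.Hyper} (hx : Lev N x) (hy : Lev N y) :
    hdist x y ≤ P.θ ^ (N + P.length) ↔ res N x = res N y := by
  by_cases h : x = y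
  · subst h
    rw [hdist_self]
    exact ⟨fun _ => rfl, fun _ => (zpow_pos P.θ_pos _).le⟩
  · obtain ⟨w, hw⟩ := sum_nonempty x (-y)
    have hwN := hx.sum (lev_neg.2 hy) hw
    have e := hw N hx (lev_neg.2 hy) hwN
    rw [hdist_eq h hw, habs_eq, ← lev_iff, ← res_eq_zero hwN, ← e, res_neg, ← sub_eq_add_neg,
      sub_eq_zero]

/-- At the largest level N containing x and y, membership in x + y means having the same residue as
c. By `hdist_le_iff` this is distance at most θ^(N + length), and max(|x|, |y|) = θ^N. For x = y = 0
both sides are {0}. -/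
theorem hadd_eq_hclosedBall {x y c : P.Hyper} (hc : c ∈ hadd x y) :
    hadd x y = hclosedBall c (P.θ ^ P.length * max (habs x) (habs y)) := by
  by_cases hxy : x ≠ 0 ∨ y ≠ 0
  · obtain ⟨N, ⟨hx, hy⟩, hN⟩ := exists_level hxy
    have hcN := hx.sum hy hc
    have e := hc N hx hy hcN
    ext z
    change z ∈ sum x y ↔ hdist c z ≤ P.θ ^ P.length * max (absVal x) (absVal y)
    rw [max_absVal hx hy hN, ← zpow_natCast, ← zpow_add₀ P.θ_pos.ne', add_comm]
    constructor
    · intro hz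
      have hzN := hx.sum hy hz
      rw [hdist_le_iff hcN hzN, ← e, hz N hx hy hzN]
    · intro hz
      -- Residues at N may be compared only once z is known to lie in level N. This follows from the
      -- ultrametric inequality, as the radius and |c| are at most θ^N.
      have hzN : Lev N z := by
        have h1 := hdist_triangle z c 0
        rw [hdist_zero, hdist_zero, hdist_comm z c] at h1
        refine lev_iff.2 (h1.trans (max_le (hz.trans ?_) (lev_iff.1 hcN)))
        rw [zpow_le_zpow_iff_right_of_lt_one₀ P.θ_pos P.θ_lt_one]
        omega
      exact mem_sum_of_res hN hx hy hzN (e.trans ((hdist_le_iff hcN hzN).1 hz))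
  · push Not at hxy
    rw [hxy.1, hxy.2, hadd_zero, Set.mem_singleton_iff] at hc
    rw [hxy.1, hxy.2, hc, hadd_zero, habs_zero, max_self, mul_zero]
    ext z
    change z = 0 ↔ hdist 0 z ≤ 0
    rw [hdist_comm, hdist_zero]
    exact ⟨fun h => h ▸ habs_zero.le, fun h =>
      (habs_eq_zero z).1 (le_antisymm h (habs_nonneg z))⟩

noncomputable instance : ValuedHyperfield P.Hyper where
  exists_isNormBound := ⟨P.θ ^ P.length, (pow_pos P.θ_pos _).le, .inl fun x y => by
    obtain ⟨c, hc⟩ := hadd_nonempty x y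
    exact ⟨c, hadd_eq_hclosedBall hc⟩⟩

/-! ### Discreteness, θ and ρ of the constructed hyperfield. -/

theorem isDiscretelyValued : IsDiscretelyValued P.Hyper := by
  have hθ := P.θ_pos
  rintro _ ⟨x, rfl⟩
  constructor
  · intro h
    obtain rfl | ⟨n, v, rfl⟩ := eq_zero_or_elt x
    · exact habs_zero
    · exfalso
      rw [accPt_iff_nhds] at h
      have h1 : P.θ ^ (n + 1) < P.θ ^ n := by
        rw [zpow_lt_zpow_iff_right_of_lt_one₀ hθ P.θ_lt_one]; omega
      have h2 : P.θ ^ n < P.θ ^ (n - 1) := by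
        rw [zpow_lt_zpow_iff_right_of_lt_one₀ hθ P.θ_lt_one]; omega
      obtain ⟨_, ⟨⟨h3, h4⟩, ⟨y, rfl⟩⟩, hne⟩ := h (Set.Ioo _ _) (Ioo_mem_nhds h1 h2)
      obtain rfl | ⟨m, w, rfl⟩ := eq_zero_or_elt y
      · rw [habs_zero] at h3
        exact absurd h3 (not_lt.2 (zpow_pos hθ _).le)
      · rw [habs_eq, absVal_elt, zpow_lt_zpow_iff_right_of_lt_one₀ hθ P.θ_lt_one] at h3 h4
        exact hne (by rw [habs_eq, habs_eq, absVal_elt, absVal_elt, show m = n by omega])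
  · intro h
    rw [h, accPt_iff_nhds]
    intro U hU
    obtain ⟨ε, hε, hεU⟩ := Metric.mem_nhds_iff.1 hU
    obtain ⟨n, hn⟩ := exists_pow_lt_of_lt_one hε P.θ_lt_one
    have hp := pow_pos hθ n
    refine ⟨P.θ ^ n, ⟨hεU ?_, ⟨P.elt n 1, ?_⟩⟩, hp.ne'⟩
    · rwa [Metric.mem_ball, dist_zero_right, Real.norm_eq_abs, abs_of_pos hp]
    · rw [habs_eq, absVal_elt, zpow_natCast]

/-- The sum 1 - 1 contains both 0 and the nonzero element π^length. -/
theorem not_isSingleValued : ¬ IsSingleValued P.Hyper := by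
  intro h
  obtain ⟨z, hz⟩ := h 1 (-1)
  have h0 : (0 : P.Hyper) ∈ hadd (1 : P.Hyper) (-1) := zero_mem_neg 1
  have h1 : P.elt P.length 1 ∈ hadd (1 : P.Hyper) (-1) := by
    rw [hadd_eq_hclosedBall h0]
    change hdist _ _ ≤ _
    rw [hdist_comm, hdist_zero, habs_neg, habs_one, max_self, mul_one, habs_eq, absVal_elt,
      zpow_natCast]
  rw [hz] at h0 h1
  exact elt_ne_zero _ _ (h1.trans h0.symm)

/-- The discretely valued hyperfield attached to `P`. -/
noncomputable def toDVHyperfield (P : ValuedUniformizer R) : DVHyperfield.{u} where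
  carrier := P.Hyper
  discrete := isDiscretelyValued
  not_field := not_isSingleValued

theorem theta_toDVHyperfield (P : ValuedUniformizer R) : P.toDVHyperfield.theta = P.θ := by
  refine IsGreatest.csSup_eq ⟨⟨P.elt 1 1, elt_ne_zero _ _, ?_, P.θ_lt_one⟩, ?_⟩
  · exact zpow_one P.θ
  · rintro _ ⟨x, hx0, rfl, hx⟩
    obtain rfl | ⟨n, v, rfl⟩ := eq_zero_or_elt (P := P) x
    · exact absurd rfl hx0
    · change P.θ ^ n < 1 at hx
      change P.θ ^ n ≤ P.θ
      rw [← zpow_zero P.θ, zpow_lt_zpow_iff_right_of_lt_one₀ P.θ_pos P.θ_lt_one] at hx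
      calc P.θ ^ n ≤ P.θ ^ (1 : ℤ) := by
            rw [zpow_le_zpow_iff_right_of_lt_one₀ P.θ_pos P.θ_lt_one]; omega
        _ = P.θ := zpow_one _

/-- The set 1 - 1 is a closed ball about 0 in two ways, with radius ρ and with radius θ^length. A
ball need not determine its radius, but `rho_spec` makes ρ a power of θ, and the elements π^n
realise all these powers. -/
theorem rho_toDVHyperfield (P : ValuedUniformizer R) : P.toDVHyperfield.rho = P.θ ^ P.length := by
  have aux : ∀ n : ℤ, P.θ ^ n ≤ P.toDVHyperfield.rho ↔ P.θ ^ n ≤ P.θ ^ P.length := by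
    intro n
    have h0 : (0 : P.Hyper) ∈ hadd (1 : P.Hyper) (-1) := zero_mem_neg 1
    have e1 := P.toDVHyperfield.rho_spec.2 _ _ _ h0
    have e2 := hadd_eq_hclosedBall h0
    have e := Set.ext_iff.1 (e1.symm.trans e2) (P.elt n 1)
    have hd : hdist (0 : P.Hyper) (P.elt n 1) = P.θ ^ n := by
      rw [hdist_comm, hdist_zero, habs_eq, absVal_elt]
    have h1 : max (habs (1 : P.Hyper)) (habs (-1 : P.Hyper)) = 1 := by
      rw [habs_neg, habs_one, max_self]
    change hdist (0 : P.Hyper) (P.elt n 1) ≤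
        P.toDVHyperfield.rho * max (habs (1 : P.Hyper)) (habs (-1 : P.Hyper)) ↔
      hdist (0 : P.Hyper) (P.elt n 1) ≤ _ * max (habs (1 : P.Hyper)) (habs (-1 : P.Hyper)) at e
    rwa [hd, h1, mul_one, mul_one] at e
  obtain ⟨k, _, hk⟩ := P.toDVHyperfield.rho_spec.1
  rw [theta_toDVHyperfield] at hk
  refine le_antisymm ?_ ?_
  · have := aux k
    rw [zpow_natCast] at this
    rw [hk]
    exact this.1 hk.ge
  · have := aux P.length
    rw [zpow_natCast] at this
    exact this.2 le_rfl

end ValuedUniformizer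

/-! ### Homomorphisms of hyperfields and of triples -/

namespace DVHyperfield

variable {A B : DVHyperfield.{u}}

/-! ### Rigidity and faithfulness. -/

/-- The closed ball of radius ρ|x| about x is x + 0 = {x}. Consequently an element of maximal
absolute value in its level is determined by its class. -/
theorem eq_of_hdist_le {x y : A} (h : hdist x y ≤ A.rho * habs x) : x = y := by
  have h1 := A.rho_spec.2 x 0 x (mem_zero x)
  rw [hadd_zero, habs_zero, max_eq_left (habs_nonneg x)] at h1
  have h2 : y ∈ ({x} : Set A) := h1 ▸ h
  exact (Set.mem_singleton_iff.1 h2).symm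

theorem eq_of_cls_eq {i : ℕ} {x y : A} {hx : habs x ≤ A.theta ^ i} {hy : habs y ≤ A.theta ^ i}
    (hxi : habs x = A.theta ^ i) (h : cls x hx = cls y hy) : x = y :=
  eq_of_hdist_le (hxi ▸ cls_eq_iff.1 h)

theorem eq_of_mkR_eq {x y : A} {hx : habs x ≤ 1} {hy : habs y ≤ 1}
    (hx1 : habs x = 1) (h : mkR x hx = mkR y hy) : x = y :=
  eq_of_hdist_le (by rw [hx1, mul_one]; exact mkR_eq_iff.1 h)

theorem exists_unif_zpow_mul {x : A} (hx : x ≠ 0) :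
    ∃ (n : ℤ) (v : A), habs v = 1 ∧ x = A.unif ^ n * v := by
  obtain ⟨n, hn⟩ := A.exists_zpow hx
  have hu := zpow_ne_zero n A.unif_ne_zero
  refine ⟨n, x / A.unif ^ n, ?_, (mul_div_cancel₀ x hu).symm⟩
  rw [habs_div, habs_zpow, A.habs_unif, hn, div_self (zpow_pos A.theta_pos n).ne']

/-- A homomorphism is determined by its values on a uniformizer and on units. -/
theorem hom_ext_of_unif {f g : VHom A B} (hu : f.toFun A.unif = g.toFun A.unif)
    (hv : ∀ v : A, habs v = 1 → f.toFun v = g.toFun v) : f = g := by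
  refine VHom.ext (funext fun x => ?_)
  by_cases hx : x = 0
  · rw [hx, f.map_zero, g.map_zero]
  · obtain ⟨n, v, h1, rfl⟩ := exists_unif_zpow_mul hx
    have e : ∀ k : VHom A B, k.toFun (A.unif ^ n) = k.toFun A.unif ^ n := fun k =>
      map_zpow₀ k.monoidHom A.unif n
    rw [f.map_mul, g.map_mul, hv v h1, e, e, hu]

theorem trη_unifM_eq (f : VHom A B) : trη f A.unifM =
    toTensorPow (ramIdx A B)
      (cls (f.toFun A.unif) (map_level f (by rw [A.habs_unif, pow_one]))) := rfl

/-- η gives the class of f(π) in M'_r and φ gives the classes of the f(v) for units v. All of these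
elements have maximal absolute value in their level, so rigidity recovers them from their classes.
-/
theorem trMap_injective : Function.Injective (trMap : VHom A B → _) := by
  intro f g h
  refine hom_ext_of_unif ?_ fun v hv => ?_
  · have h1 : (trη f A.unifM : TensorAlgebra B.TrR B.TrM) = trη g A.unifM :=
      congrArg (fun F : Triple.Hom A.trObj B.trObj =>
        (F.η A.unifM : TensorAlgebra B.trObj.R B.trObj.M)) h
    have h2 := toTensorPow_bijective.1 (Subtype.ext h1 : trη f A.unifM = trη g A.unifM)
    refine eq_of_cls_eq ?_ h2
    rw [f.habs_map, A.habs_unif, ← (theta_eq_pow f).2]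
  · have h1 : trφ f (mkR v hv.le) = trφ g (mkR v hv.le) :=
      congrArg (fun F : Triple.Hom A.trObj B.trObj => F.φ (mkR v hv.le)) h
    rw [trφ_mkR, trφ_mkR] at h1
    exact eq_of_mkR_eq ((f.habs_map v).trans hv) h1

/-! ### Lifting a morphism of triples to a homomorphism. -/

/-- Sums are detected by the ring `R` if the larger summand has absolute value `1`. -/
theorem mem_hadd_of_mkR {x y z : A} {hx : habs x ≤ 1} {hy : habs y ≤ 1} {hz : habs z ≤ 1}
    (hxy : max (habs x) (habs y) = 1) (h : mkR x hx + mkR y hy = mkR z hz) : z ∈ hadd x y := by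
  obtain ⟨w, hw⟩ := hadd_nonempty x y
  rw [mkR_add hx hy hw, mkR_eq_iff] at h
  rw [A.rho_spec.2 x y w hw, hxy, mul_one]
  exact h

/-- A representative of a generator of `M_i` has absolute value `θ ^ i`. -/
theorem habs_of_isGen {i : ℕ} {x : A} {hx : habs x ≤ A.theta ^ i}
    (h : IsGen A.TrR (cls (i := i) x hx)) : habs x = A.theta ^ i := by
  refine le_antisymm hx ?_
  obtain ⟨a, ha⟩ := h.2 (cls (A.unif ^ i) habs_unif_pow_le)
  obtain ⟨y, hy, rfl⟩ := mkR_surj a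
  simp only [mkR_smul] at ha
  rw [cls_eq_iff, hdist_comm] at ha
  have hp := pow_pos A.theta_pos i
  have e := habs_eq_of_hdist_lt (lt_of_le_of_lt ha (by
    rw [habs_pow, A.habs_unif]
    exact mul_lt_of_lt_one_left hp rho_lt_one))
  rw [habs_mul, habs_pow, A.habs_unif] at e
  rw [← e]
  exact mul_le_of_le_one_left (habs_nonneg x) hy

/-- Under M_i ≅ M^{⊗ i}, the map ε_{0,i} is induced by the inclusion of 𝔪^i in the valuation ring.
This translates φε = ε'η into φ[π] = [p]. -/
theorem epsPow_toTensorPow {i : ℕ} {x : A} (hx : habs x ≤ A.theta ^ i) :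
    epsPow A.epsM i (toTensorPow i (cls x hx)) =
      mkR x (hx.trans (pow_le_one₀ A.theta_pos.le A.theta_lt_one.le)) := by
  have h0 := pow_ne_zero i A.unif_ne_zero
  have hq : habs (x / A.unif ^ i) ≤ 1 := by
    rw [habs_div, habs_pow, A.habs_unif]
    exact div_le_one_of_le₀ hx (pow_pos A.theta_pos i).le
  have e : cls x hx = mkR (x / A.unif ^ i) hq • cls (A.unif ^ i) habs_unif_pow_le := by
    rw [mkR_smul]
    exact cls_congr (div_mul_cancel₀ x h0).symm
  have h1 : epsPow A.epsM i (genPow A.TrR A.unifM i) = mkR A.unif habs_unif_le_one ^ i := by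
    simp only [epsPow, genPow, LinearMap.comp_apply, Submodule.subtype_apply,
      AlgHom.toLinearMap_apply, map_pow, TensorAlgebra.lift_ι_apply]
    rfl
  rw [e, toTensorPow_smul, map_smul, h1, smul_eq_mul, mkR_pow, mkR_mul]
  exact mkR_congr (div_mul_cancel₀ x h0)

section Lift

variable (φ : A.TrR →+* B.TrR) (p : B)

/-- The graph of the multiplicative map `A → B` which sends the uniformizer to `p` and is given on
units by `φ`. -/
def LiftRel (x : A) (y : B) : Prop :=
  (x = 0 ∧ y = 0) ∨ ∃ (n : ℤ) (v : A) (w : B) (hv : habs v = 1) (hw : habs w = 1),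
    x = A.unif ^ n * v ∧ y = p ^ n * w ∧ φ (mkR v hv.le) = mkR w hw.le

variable {φ p}

theorem exists_liftRel (x : A) : ∃ y, LiftRel φ p x y := by
  by_cases hx : x = 0
  · exact ⟨0, .inl ⟨hx, rfl⟩⟩
  · obtain ⟨n, v, hv, rfl⟩ := exists_unif_zpow_mul hx
    obtain ⟨w, hw, e⟩ := mkR_surj (φ (mkR v hv.le))
    have hw1 : habs w = 1 := isUnit_mkR.1 (e ▸ (isUnit_mkR_of_eq hv).map φ)
    exact ⟨p ^ n * w, .inr ⟨n, v, w, hv, hw1, rfl, rfl, e.symm⟩⟩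

theorem LiftRel.habs_eq (hp : habs p = A.theta) {x : A} {y : B} (h : LiftRel φ p x y) :
    habs y = habs x := by
  obtain ⟨rfl, rfl⟩ | ⟨n, v, w, hv, hw, rfl, rfl, -⟩ := h
  · rw [habs_zero, habs_zero]
  · rw [habs_mul, habs_mul, habs_zpow, habs_zpow, hp, A.habs_unif, hv, hw]

/-- The absolute value of x fixes n, hence also v, and w is fixed by its class because |w| = 1. The
relation is therefore a function, independent of the chosen representatives. -/
theorem LiftRel.unique (hp : habs p = A.theta) {x : A} {y y' : B} (h : LiftRel φ p x y)
    (h' : LiftRel φ p x y') : y = y' := by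
  obtain ⟨rfl, rfl⟩ | ⟨n, v, w, hv, hw, rfl, rfl, e⟩ := h
  · exact ((habs_eq_zero _).1 ((h'.habs_eq hp).trans habs_zero)).symm
  · obtain ⟨h0, -⟩ | ⟨m, v', w', hv', hw', e', rfl, e''⟩ := h'
    · have := congrArg habs h0
      rw [habs_zero, habs_mul, habs_zpow, hv, mul_one, A.habs_unif] at this
      exact absurd this (zpow_pos A.theta_pos n).ne'
    · have hnm : n = m := by
        have := congrArg habs e'
        rw [habs_mul, habs_mul, habs_zpow, habs_zpow, hv, hv', mul_one, mul_one,
          A.habs_unif] at this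
        exact zpow_right_injective₀ A.theta_pos A.theta_lt_one.ne this
      subst hnm
      have hvv := mul_left_cancel₀ (zpow_ne_zero n A.unif_ne_zero) e'
      subst hvv
      rw [eq_of_mkR_eq hw (e.symm.trans e'')]

theorem LiftRel.mul {x x' : A} {y y' : B} (hp0 : p ≠ 0) (h : LiftRel φ p x y)
    (h' : LiftRel φ p x' y') : LiftRel φ p (x * x') (y * y') := by
  obtain ⟨rfl, rfl⟩ | ⟨n, v, w, hv, hw, rfl, rfl, e⟩ := h
  · exact .inl ⟨zero_mul _, zero_mul _⟩
  obtain ⟨rfl, rfl⟩ | ⟨m, v', w', hv', hw', rfl, rfl, e'⟩ := h'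
  · exact .inl ⟨mul_zero _, mul_zero _⟩
  refine .inr ⟨n + m, v * v', w * w', by rw [habs_mul, hv, hv', mul_one],
    by rw [habs_mul, hw, hw', mul_one], ?_, ?_, ?_⟩
  · rw [zpow_add₀ A.unif_ne_zero, mul_mul_mul_comm]
  · rw [zpow_add₀ hp0, mul_mul_mul_comm]
  · rw [← mkR_mul hv.le hv'.le, ← mkR_mul hw.le hw'.le, map_mul, e, e']

theorem liftRel_zpow (n : ℤ) : LiftRel φ p (A.unif ^ n) (p ^ n) :=
  .inr ⟨n, 1, 1, habs_one, habs_one, (mul_one _).symm, (mul_one _).symm, map_one φ⟩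

/-- On units this is the definition of the relation. The hypothesis φ[π] = [p] extends it to
products π^n v with n ≥ 0, that is, to the whole valuation ring. -/
theorem LiftRel.mkR_eq (hp : habs p = A.theta) (hφ : φ A.unifR = mkR p (hp ▸ A.theta_lt_one.le))
    {x : A} {y : B} (h : LiftRel φ p x y) (hx : habs x ≤ 1) :
    φ (mkR x hx) = mkR y ((h.habs_eq hp).trans_le hx) := by
  obtain ⟨rfl, rfl⟩ | ⟨n, v, w, hv, hw, rfl, rfl, e⟩ := id h
  · exact map_zero φ
  · have hn : 0 ≤ n := by
      rw [habs_mul, habs_zpow, hv, mul_one, A.habs_unif] at hx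
      rwa [← A.zpow_le_iff, zpow_zero]
    lift n to ℕ using hn
    have e1 : mkR (A.unif ^ (n : ℤ) * v) hx = A.unifR ^ n * mkR v hv.le := by
      rw [unifR, mkR_pow, mkR_mul]
      exact mkR_congr (by rw [zpow_natCast])
    rw [e1, map_mul, map_pow, hφ, e, mkR_pow, mkR_mul]
    exact mkR_congr (by rw [zpow_natCast])

/-- Scale by π^(-N) on one side and p^(-N) on the other so that the larger summand has absolute
value 1. Sums are then detected in R and respected by φ, and p^N scales back. The case x = y = 0
admits no such scaling and is treated separately. -/
theorem LiftRel.hadd (hp : habs p = A.theta) (hφ : φ A.unifR = mkR p (hp ▸ A.theta_lt_one.le))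
    {x y z : A} {x' y' z' : B} (hx : LiftRel φ p x x') (hy : LiftRel φ p y y')
    (hz : LiftRel φ p z z') (h : z ∈ hadd x y) : z' ∈ hadd x' y' := by
  have hp0 : p ≠ 0 := by
    rintro rfl
    rw [habs_zero] at hp
    exact A.theta_pos.ne hp
  by_cases hxy : x = 0 ∧ y = 0
  · obtain ⟨rfl, rfl⟩ := hxy
    rw [hadd_zero, Set.mem_singleton_iff] at h
    subst h
    have aux : LiftRel φ p 0 0 := .inl ⟨rfl, rfl⟩
    rw [hx.unique hp aux, hy.unique hp aux, hz.unique hp aux, hadd_zero]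
    rfl
  obtain ⟨N, hN⟩ : ∃ N : ℤ, max (habs x) (habs y) = A.theta ^ N := by
    rcases max_cases (habs x) (habs y) with ⟨h1, h2⟩ | ⟨h1, h2⟩ <;> rw [h1]
    · refine A.exists_zpow ?_
      rintro rfl
      rw [habs_zero] at h2
      exact hxy ⟨rfl, (habs_eq_zero y).1 (le_antisymm h2 (habs_nonneg y))⟩
    · refine A.exists_zpow ?_
      rintro rfl
      rw [habs_zero] at h2
      exact absurd h2 (not_lt.2 (habs_nonneg x))
  have hNp := zpow_pos A.theta_pos N
  have hsc := liftRel_zpow (A := A) (φ := φ) (p := p) (-N)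
  have hx1 := hx.mul hp0 hsc
  have hy1 := hy.mul hp0 hsc
  have hz1 := hz.mul hp0 hsc
  have habs_sc : ∀ w : A, habs (w * A.unif ^ (-N)) = habs w / A.theta ^ N := fun w => by
    rw [habs_mul, habs_zpow, A.habs_unif, zpow_neg, div_eq_mul_inv]
  have lx : habs (x * A.unif ^ (-N)) ≤ 1 := by
    rw [habs_sc, div_le_one hNp, ← hN]; exact le_max_left _ _
  have ly : habs (y * A.unif ^ (-N)) ≤ 1 := by
    rw [habs_sc, div_le_one hNp, ← hN]; exact le_max_right _ _
  have hm := mul_mem (A.unif ^ (-N)) h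
  have lz := (habs_hadd_le _ _ _ hm).trans (max_le lx ly)
  have e := congrArg φ (mkR_add lx ly hm)
  rw [map_add, hx1.mkR_eq hp hφ lx, hy1.mkR_eq hp hφ ly, hz1.mkR_eq hp hφ lz] at e
  have hmem := mem_hadd_of_mkR (by
    rw [hx1.habs_eq hp, hy1.habs_eq hp, habs_sc, habs_sc, max_div_div_right hNp.le, hN,
      div_self hNp.ne']) e
  have := mul_mem (p ^ N) hmem
  simpa only [mul_assoc, ← zpow_add₀ hp0, neg_add_cancel, zpow_zero, mul_one] using this

end Lift

/-- A morphism of triples which is compatible with the absolute values comes from a homomorphism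
of hyperfields. -/
theorem exists_trMap_eq (F : Triple.Hom A.trObj B.trObj) (hr : A.theta = B.theta ^ F.r) :
    ∃ f : VHom A B, trMap f = F := by
  obtain ⟨r, r_pos, φ, η, comm, bij⟩ := F
  change A.TrR →+* B.TrR at φ
  change A.TrM →ₛₗ[φ] tensorPow B.TrR B.TrM r at η
  change A.theta = B.theta ^ r at hr
  obtain rfl : ramIdx A B = r := ramIdx_eq hr
  -- p represents η(π) under M'_r ≅ M'^{⊗ r}; it will be the image of the uniformizer.
  obtain ⟨c, hc⟩ := toTensorPow_bijective.2 (η A.unifM)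
  obtain ⟨p, hp, rfl⟩ := cls_surj c
  have hgen : IsGen B.TrR (η A.unifM) := (inducedMap_bijective_iff φ η isGen_unifM).1 bij
  have hgen' : IsGen B.TrR (cls p hp) := by
    have : (fun a : B.TrR => a • η A.unifM) =
        toTensorPow (ramIdx A B) ∘ fun a : B.TrR => a • cls p hp := by
      funext a
      rw [← hc, Function.comp_apply, map_smul]
    rw [IsGen, this] at hgen
    exact (Function.Bijective.of_comp_iff' toTensorPow_bijective _).1 hgen
  -- Membership in the level only bounds |p|. Equality holds because the isomorphism condition makes
  -- the class of p a generator of M'_r.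
  have hpA : habs p = A.theta := (habs_of_isGen hgen').trans hr.symm
  have hφ : φ A.unifR = mkR p (hpA ▸ A.theta_lt_one.le) := by
    have h1 : φ A.unifR = epsPow B.epsM (ramIdx A B) (η A.unifM) := comm A.unifM
    rw [h1, ← hc, epsPow_toTensorPow]
  choose g hg using exists_liftRel (φ := φ) (p := p)
  have hp0 : p ≠ 0 := by
    rintro rfl
    rw [habs_zero] at hpA
    exact A.theta_pos.ne hpA
  let f : VHom A B := VHom.ofMapHadd g
    (fun x y => (hg (x * y)).unique hpA ((hg x).mul hp0 (hg y)))
    (fun x y z h => (hg x).hadd hpA hφ (hg y) (hg z) h) fun x => (hg x).habs_eq hpA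
  have hfu : f.toFun A.unif = p := by
    have := liftRel_zpow (A := A) (φ := φ) (p := p) 1
    rw [zpow_one, zpow_one] at this
    exact (hg A.unif).unique hpA this
  have hfφ : ∀ a, trφ f a = φ a := fun a => by
    obtain ⟨x, hx, rfl⟩ := mkR_surj a
    exact ((hg x).mkR_eq hpA hφ hx).symm
  refine ⟨f, Triple.Hom.ext rfl hfφ fun x => ?_⟩
  obtain ⟨a, rfl⟩ := (isGen_unifM (H := A)).2 x
  change (trη f (a • A.unifM) : TensorAlgebra B.TrR B.TrM) = η (a • A.unifM)
  rw [LinearMap.map_smulₛₗ, LinearMap.map_smulₛₗ, hfφ, ← hc, trη_unifM_eq, cls_congr hfu]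

end DVHyperfield

/-! ### Realisation of triples -/

namespace Triple

variable {A B : Triple.{u}}

/-! ### Triples in terms of generators. -/

/-- Morphisms of triples are determined by their values on a generator. -/
theorem Hom.ext_of_isGen {F G : Hom A B} {a : A.M} (ha : IsGen A.R a) (hr : F.r = G.r)
    (hφ : ∀ x, F.φ x = G.φ x) (hη : (F.η a : TensorAlgebra B.R B.M) = G.η a) : F = G := by
  refine Hom.ext hr hφ fun x => ?_
  obtain ⟨c, rfl⟩ := ha.2 x
  simp only [LinearMap.map_smulₛₗ, Submodule.coe_smul, hφ, hη]

/-- The morphism with `r = 1` which is given on the rings by `φ` and sends the generator `a` to the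
generator `b`. -/
noncomputable def homOfGen (φ : A.R →+* B.R) {a : A.M} (ha : IsGen A.R a) {b : B.M}
    (hb : IsGen B.R b) (h : φ (A.ε a) = B.ε b) : Hom A B :=
  let e : A.R ≃ₗ[A.R] A.M := LinearEquiv.ofBijective (LinearMap.toSpanSingleton A.R A.M a) ha
  have he : e.symm a = 1 := e.symm_apply_eq.2 (one_smul A.R a).symm
  { r := 1
    r_pos := one_pos
    φ := φ
    η :=
      { toFun := fun x => φ (e.symm x) • genPow B.R b 1
        map_add' := fun x y => by rw [map_add, map_add, add_smul]
        map_smul' := fun c x => by rw [map_smul, smul_eq_mul, map_mul, mul_smul] }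
    comm := fun x => by
      obtain ⟨c, rfl⟩ := ha.2 x
      have h1 : epsPow B.ε 1 (genPow B.R b 1) = B.ε b := by
        simp [epsPow, genPow]
      simp only [LinearMap.coe_mk, AddHom.coe_mk, map_smul, smul_eq_mul, map_mul, he, mul_one, h1,
        h]
    bijective := by
      refine (inducedMap_bijective_iff _ _ ha).2 ?_
      simp only [LinearMap.coe_mk, AddHom.coe_mk, he, map_one, one_smul]
      exact hb.genPow 1 }

theorem homOfGen_η (φ : A.R →+* B.R) {a : A.M} (ha : IsGen A.R a) {b : B.M}
    (hb : IsGen B.R b) (h : φ (A.ε a) = B.ε b) :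
    ((homOfGen φ ha hb h).η a : TensorAlgebra B.R B.M) = TensorAlgebra.ι B.R b := by
  let e : A.R ≃ₗ[A.R] A.M := LinearEquiv.ofBijective (LinearMap.toSpanSingleton A.R A.M a) ha
  have he : e.symm a = 1 := e.symm_apply_eq.2 (one_smul A.R a).symm
  change ((φ (e.symm a) • genPow B.R b 1 : tensorPow B.R B.M 1) : TensorAlgebra B.R B.M) = _
  rw [he, map_one, one_smul]
  exact pow_one _

theorem homOfGen_comp (φ : A.R →+* B.R) (ψ : B.R →+* A.R) (hψ : ∀ x, ψ (φ x) = x) {a : A.M}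
    (ha : IsGen A.R a) {b : B.M} (hb : IsGen B.R b) (h : φ (A.ε a) = B.ε b)
    (h' : ψ (B.ε b) = A.ε a) :
    (homOfGen ψ hb ha h').comp (homOfGen φ ha hb h) = Hom.id A := by
  refine Hom.ext_of_isGen ha rfl hψ ?_
  rw [Hom.comp_η, Hom.id_η, homOfGen_η, tensorExt_ι, homOfGen_η]

/-- Two triples are isomorphic if there is an isomorphism between their rings which is compatible
with the values of `ε` on generators. -/
noncomputable def isoOfGen (φ : A.R ≃+* B.R) {a : A.M} (ha : IsGen A.R a) {b : B.M}
    (hb : IsGen B.R b) (h : φ (A.ε a) = B.ε b) : A ≅ B where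
  hom := homOfGen (φ : A.R →+* B.R) ha hb h
  inv := homOfGen (φ.symm : B.R →+* A.R) hb ha (φ.symm_apply_eq.2 h.symm)
  hom_inv_id := homOfGen_comp _ _ φ.symm_apply_apply ha hb h _
  inv_hom_id := homOfGen_comp _ _ φ.apply_symm_apply hb ha _ h

/-- Isomorphisms of triples have ramification index one. -/
theorem r_eq_one (e : A ≅ B) : Hom.r e.hom = 1 ∧ Hom.r e.inv = 1 := by
  have h : Hom.r e.inv * Hom.r e.hom = 1 := congrArg Hom.r e.hom_inv_id
  exact ⟨Nat.eq_one_of_mul_eq_one_left h, Nat.eq_one_of_mul_eq_one_right h⟩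

theorem span_ε (T : Triple.{u}) {m : T.M} (hm : IsGen T.R m) :
    Ideal.span {T.ε m} = IsLocalRing.maximalIdeal T.R := by
  rw [← T.range_ε]
  ext a
  rw [Ideal.mem_span_singleton', LinearMap.mem_range]
  constructor
  · rintro ⟨c, rfl⟩
    exact ⟨c • m, map_smul _ _ _⟩
  · rintro ⟨x, rfl⟩
    obtain ⟨c, rfl⟩ := hm.2 x
    exact ⟨c, (map_smul T.ε c m).symm⟩

/-- The value of `ε` on a generator as a uniformizer. -/
noncomputable def valuedUniformizer (T : Triple.{u}) {m : T.M} (hm : IsGen T.R m) (θ : ℝ)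
    (h0 : 0 < θ) (h1 : θ < 1) : ValuedUniformizer T.R :=
  have nil : IsNilpotent (T.ε m) := by
    obtain ⟨n, hn⟩ := (isArtinianRing_iff_isNilpotent_maximalIdeal T.R).1 inferInstance
    refine ⟨n, ?_⟩
    have := Ideal.pow_mem_pow (Ideal.mem_span_singleton_self (T.ε m)) n
    rwa [T.span_ε hm, hn] at this
  { π := T.ε m
    θ := θ
    θ_pos := h0
    θ_lt_one := h1
    isNilpotent := nil
    exists_eq := fun a ha => by
      classical
      obtain ⟨k, hk⟩ := nil
      -- The exponent is the largest n with π^n dividing a, found as the least n for which π^(n+1)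
      -- does not divide a. It exists because a ≠ 0 and π is nilpotent.
      have hex : ∃ n, ¬ T.ε m ^ (n + 1) ∣ a := ⟨k, fun h => ha (by
        rwa [pow_succ, hk, zero_mul, zero_dvd_iff] at h)⟩
      have hdvd : T.ε m ^ Nat.find hex ∣ a := by
        rcases h : Nat.find hex with _ | n
        · rw [pow_zero]; exact one_dvd a
        · exact not_not.1 (Nat.find_min hex (by omega : n < Nat.find hex))
      obtain ⟨c, hc⟩ := hdvd
      -- A nonunit cofactor would lie in the maximal ideal (π) and contribute one more factor π.
      have hu : IsUnit c := by
        by_contra hn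
        rw [← mem_nonunits_iff, ← IsLocalRing.mem_maximalIdeal, ← T.span_ε hm,
          Ideal.mem_span_singleton] at hn
        apply Nat.find_spec hex
        conv_rhs => rw [hc]
        rw [pow_succ]
        exact mul_dvd_mul_left _ hn
      exact ⟨Nat.find hex, hu.unit, hc⟩ }

end Triple

/-! ### Recovering the ring from the constructed hyperfield. -/

namespace ValuedUniformizer

open DVHyperfield

variable {R : Type u} [CommRing R] [IsLocalRing R] (P : ValuedUniformizer R)

theorem lev_zero_iff {x : P.Hyper} : Lev 0 x ↔ habs x ≤ 1 := by
  rw [lev_iff, zpow_zero]; rfl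

/-- The congruence defining M_0 is equality of residues at level 0, so the residue map identifies
M_0 with R. -/
theorem hdist_le_rho_iff {x y : P.Hyper} (hx : habs x ≤ 1) (hy : habs y ≤ 1) :
    hdist x y ≤ P.toDVHyperfield.rho ↔ res 0 x = res 0 y := by
  rw [← hdist_le_iff (P.lev_zero_iff.2 hx) (P.lev_zero_iff.2 hy), rho_toDVHyperfield, zero_add,
    zpow_natCast]

/-- The map from the ring of the hyperfield of `P` to `R`. -/
noncomputable def ringHom : P.toDVHyperfield.TrR →+* R where
  toFun := Quotient.lift (fun x : P.toDVHyperfield.Level 0 => res 0 (x.1 : P.Hyper))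
    fun x y h => by
      have h' : hdist x.1 y.1 ≤ P.toDVHyperfield.rho * P.toDVHyperfield.theta ^ 0 := h
      exact (P.hdist_le_rho_iff (x.2.trans_eq (pow_zero _)) (y.2.trans_eq (pow_zero _))).1
        (h'.trans_eq (by rw [pow_zero, mul_one]))
  map_one' := by
    change res 0 (P.elt 0 1) = 1
    rw [res_elt_self, Units.val_one]
  map_zero' := rfl
  map_mul' a b := by
    obtain ⟨x, hx, rfl⟩ := mkR_surj a
    obtain ⟨y, hy, rfl⟩ := mkR_surj b
    exact res_mul (P.lev_zero_iff.2 hx) (P.lev_zero_iff.2 hy)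
  map_add' a b := by
    obtain ⟨x, hx, rfl⟩ := mkR_surj a
    obtain ⟨y, hy, rfl⟩ := mkR_surj b
    obtain ⟨z, hz⟩ := hadd_nonempty x y
    rw [mkR_add hx hy hz]
    have lx := P.lev_zero_iff.2 hx
    have ly := P.lev_zero_iff.2 hy
    exact (hz 0 lx ly (lx.sum ly hz)).symm

theorem ringHom_bijective : Function.Bijective P.ringHom := by
  constructor
  · intro a b h
    obtain ⟨x, hx, rfl⟩ := mkR_surj a
    obtain ⟨y, hy, rfl⟩ := mkR_surj b
    exact mkR_eq_iff.2 ((P.hdist_le_rho_iff hx hy).2 h)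
  · intro r
    obtain ⟨x, hx, rfl⟩ := exists_res (P := P) 0 r
    exact ⟨mkR (H := P.toDVHyperfield) x (P.lev_zero_iff.1 hx), rfl⟩

end ValuedUniformizer

/-- Every triple is isomorphic to the triple of a hyperfield with given `θ`. -/
theorem Triple.exists_iso_trObj (T : Triple.{u}) {θ : ℝ} (h0 : 0 < θ) (h1 : θ < 1) :
    ∃ H : DVHyperfield.{u}, H.theta = θ ∧ Nonempty (H.trObj ≅ T) := by
  obtain ⟨m, hm⟩ := exists_isGen T.finrank_eq_one
  let P := T.valuedUniformizer hm θ h0 h1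
  have hθ : P.toDVHyperfield.theta = θ := P.theta_toDVHyperfield
  have hp : habs (P.elt 1 1 : P.toDVHyperfield) = P.toDVHyperfield.theta ^ 1 := by
    rw [pow_one, hθ]
    exact zpow_one θ
  refine ⟨P.toDVHyperfield, hθ, ⟨Triple.isoOfGen (A := P.toDVHyperfield.trObj)
    (RingEquiv.ofBijective P.ringHom P.ringHom_bijective) (DVHyperfield.isGen_cls hp) hm ?_⟩⟩
  -- The generator of M_1 is the class of the formal uniformizer π. Its image in R is the residue at
  -- level 0, which is ε(m) by the choice of π.
  change ValuedUniformizer.res 0 (P.elt 1 1) = T.ε m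
  rw [ValuedUniformizer.res_elt]
  simp [P, Triple.valuedUniformizer]

/-! ### The slice and coslice equivalences. -/

/-- A morphism of triples of hyperfields which is compatible with the absolute values is in the
image of `Tr`. -/
theorem Tr.exists_map_eq {A B : DVHyperfield.{u}} (F : Tr.obj A ⟶ Tr.obj B)
    (hr : A.theta = B.theta ^ Triple.Hom.r F) : ∃ f : A ⟶ B, Tr.map f = F :=
  DVHyperfield.exists_trMap_eq F hr

theorem Tr.theta_eq {A B : DVHyperfield.{u}} (f : A ⟶ B) :
    A.theta = B.theta ^ Triple.Hom.r (Tr.map f) :=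
  (DVHyperfield.theta_eq_pow f).2

theorem mainTheorem4 (H : DVHyperfield.{u}) :
    (Under.post (X := H) Tr.{u}).IsEquivalence ∧
      (Over.post (X := H) Tr.{u}).IsEquivalence := by
  -- Faithfulness of both induced functors is inherited from this by instance search.
  have : Tr.{u}.Faithful := ⟨fun {A B} f g h => DVHyperfield.trMap_injective h⟩
  constructor
  · refine { full := ⟨fun {X Y} F => ?_⟩, essSurj := ⟨fun Y => ?_⟩ }
    · obtain ⟨G, hG⟩ : ∃ G : Tr.obj X.right ⟶ Tr.obj Y.right, G = F.right := ⟨_, rfl⟩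
      have w : Tr.map X.hom ≫ G = Tr.map Y.hom := by subst hG; exact Under.w F
      have hr : Triple.Hom.r G * Triple.Hom.r (Tr.map X.hom) = Triple.Hom.r (Tr.map Y.hom) :=
        congrArg Triple.Hom.r w
      -- The number θ_H equals both θ_X^(r_X) and θ_Y^(r_Y), where r_Y = r_G r_X. Taking r_X-th
      -- roots of positive reals gives θ_X = θ_Y^(r_G).
      obtain ⟨f, hf⟩ := Tr.exists_map_eq G (by
        rw [← pow_left_inj₀ X.right.theta_pos.le (pow_pos Y.right.theta_pos _).le
          (Triple.Hom.r_pos (Tr.map X.hom)).ne', ← pow_mul, hr]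
        exact (Tr.theta_eq X.hom).symm.trans (Tr.theta_eq Y.hom))
      -- The lift commutes with the structure maps from H because its image under the faithful
      -- functor does.
      exact ⟨Under.homMk f (Tr.map_injective (by rw [Tr.map_comp, hf, w])),
        Under.UnderMorphism.ext (hf.trans hG)⟩
    · have hr0 : Triple.Hom.r Y.hom ≠ 0 := (Triple.Hom.r_pos Y.hom).ne'
      have hi : (0 : ℝ) < (Triple.Hom.r Y.hom : ℝ)⁻¹ :=
        inv_pos.2 (Nat.cast_pos.2 (Triple.Hom.r_pos Y.hom))
      -- The value θ_H^(1/r) is the only one compatible with a homomorphism H → H' of index r.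
      -- Composing with an isomorphism of triples does not change r.
      obtain ⟨H', hθ, ⟨e⟩⟩ := Triple.exists_iso_trObj Y.right
        (Real.rpow_pos_of_pos H.theta_pos _)
        (Real.rpow_lt_one H.theta_pos.le H.theta_lt_one hi)
      change Tr.obj H' ≅ Y.right at e
      obtain ⟨f, hf⟩ := Tr.exists_map_eq (A := H) (B := H') (Y.hom ≫ e.inv) (by
        have hr : Triple.Hom.r (Y.hom ≫ e.inv) = Triple.Hom.r e.inv * Triple.Hom.r Y.hom := rfl
        rw [hr, (Triple.r_eq_one e).2, one_mul, hθ, Real.rpow_inv_natCast_pow H.theta_pos.le hr0])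
      refine ⟨Under.mk f, ⟨Under.isoMk e ?_⟩⟩
      change Tr.map f ≫ e.hom = Y.hom
      rw [hf, Category.assoc, e.inv_hom_id, Category.comp_id]
  · refine { full := ⟨fun {X Y} F => ?_⟩, essSurj := ⟨fun Y => ?_⟩ }
    · obtain ⟨G, hG⟩ : ∃ G : Tr.obj X.left ⟶ Tr.obj Y.left, G = F.left := ⟨_, rfl⟩
      have w : G ≫ Tr.map Y.hom = Tr.map X.hom := by subst hG; exact Over.w F
      have hr : Triple.Hom.r (Tr.map Y.hom) * Triple.Hom.r G = Triple.Hom.r (Tr.map X.hom) :=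
        congrArg Triple.Hom.r w
      -- Here θ_X = θ_H^(r_X) = (θ_H^(r_Y))^(r_G) = θ_Y^(r_G), so no root is needed.
      obtain ⟨f, hf⟩ := Tr.exists_map_eq G (by
        refine (Tr.theta_eq X.hom).trans ?_
        rw [← hr, pow_mul]
        exact congrArg (· ^ _) (Tr.theta_eq Y.hom).symm)
      exact ⟨Over.homMk f (Tr.map_injective (by rw [Tr.map_comp, hf, w])),
        Over.OverMorphism.ext (hf.trans hG)⟩
    -- A homomorphism H' → H of index r forces θ_{H'} = θ_H^r.
    · obtain ⟨H', hθ, ⟨e⟩⟩ := Triple.exists_iso_trObj Y.left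
        (pow_pos H.theta_pos (Triple.Hom.r Y.hom))
        (pow_lt_one₀ H.theta_pos.le H.theta_lt_one (Triple.Hom.r_pos Y.hom).ne')
      change Tr.obj H' ≅ Y.left at e
      obtain ⟨f, hf⟩ := Tr.exists_map_eq (A := H') (B := H) (e.hom ≫ Y.hom) (by
        have hr : Triple.Hom.r (e.hom ≫ Y.hom) = Triple.Hom.r Y.hom * Triple.Hom.r e.hom := rfl
        rw [hr, (Triple.r_eq_one e).1, mul_one, hθ])
      refine ⟨Over.mk f, ⟨Over.isoMk e ?_⟩⟩
      change e.hom ≫ Y.hom = Tr.map f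
      rw [hf]
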